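/- Let $d\in\mathbb N$ and $L>0$. Let $L^2_{\rm per}$ be the space of $L\mathbb Z^d$-periodic, locally square-integrable functions, with the scalar product of $L^2([0,L)^d)$. For $n\in\mathbb Z^d$ put $k_n=\frac{2\pi}{L}n$ and $e_n(x)=L^{-d/2}e^{ik_n\cdot x}$. For $s\in\mathbb R$, let $H^s_{\rm per}$ be the space of the $u=\sum_n u_n e_n$ with $\sum_n(1+|k_n|^2)^s|u_n|^2<\infty$. Let $V$ be a real, $L\mathbb Z^d$-periodic potential (function or distribution) such that, for some $r>0$, $$\|V\|_r:=\|(-\Delta+1)^{-1/2+r/2}\,V\,(-\Delta+1)^{-1/2+r/2}\|_{\mathcal L(L^2_{\rm per})}<\infty ,$$ and let $\mathcal H=-\Delta+V$ on $L^2_{\rm per}$, with eigenfunctions in $H^1_{\rm per}$ understood in the weak sense. For an integer $M\ge1$ let $\rho_M=(2\pi M/L)^2$, let $P_M$ be the orthogonal projection onto $X_M=\mathrm{span}\{e_n:\ |k_n|^2<\rho_M\}$, let $P_M^\perp=1-P_M$ and $\mathcal H_M^\perp=P_M^\perp\mathcal H P_M^\perp$, and set $$\kappa_M=\rho_M-(\rho_M+1)\rho_M^{-r}\|V\|_r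 .$$ On $X_M$ let $$\mathcal H_M(\lambda)=P_M(-\Delta+V)P_M+U_M(\lambda),\qquad U_M(\lambda)=-P_MVP_M^\perp(\mathcal H_M^\perp-\lambda)^{-1}P_M^\perp VP_M .$$ Assume that $M$ is so large that $\rho_M^{-r}\|V\|_r\le 1$. Then, for every real $\lambda<\kappa_M$, the operator $\mathcal H_M^\perp-\lambda:\ P_M^\perp H^1_{\rm per}\to P_M^\perp H^{-1}_{\rm per}$ is invertible and $\mathcal H_M(\lambda)$ is self-adjoint. For $1\le i\le\dim X_M$, denote by $\nu_{Mi}(\lambda)$ the $i$-th eigenvalue of $\mathcal H_M(\lambda)$, in increasing order and counted with multiplicity. Then the equation $\nu_{Mi}(\lambda)=\lambda$ has at most one solution in $(-\infty,\kappa_M)$; and if the $i$-th eigenvalue of $\mathcal H$ (in increasing order, counted with multiplicity) is smaller than $\kappa_M$, then it has exactly one solution in $(-\infty,\kappa_M)$. -/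

import Mathlib

noncomputable section

namespace FeshbachSchur

/-! Everything is written in the orthonormal plane-wave basis `e_n(x) = L^(-d/2) exp(i k_n · x)`,
`k_n = (2π/L) n`, `n ∈ ℤ^d`, of `L²_per`. A periodic function or distribution is given by its
Fourier coefficients, and `L²_per` is `ℓ²(ℤ^d; ℂ)` (Parseval). -/

/-- Indices `n ∈ ℤ^d` of the points `k_n = (2π/L) n` of the reciprocal lattice of `Lℤ^d`. -/
abbrev Freq (d : ℕ) : Type := Fin d → ℤ

/-- `|k_n|²`, the eigenvalue of `-Δ` on the plane wave `e_n`. -/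
def kSq {d : ℕ} (L : ℝ) (n : Freq d) : ℝ :=
  (2 * Real.pi / L) ^ 2 * ∑ j, (n j : ℝ) ^ 2

/-- The Hilbert space `L²_per`, through Fourier coefficients. -/
abbrev L2per (d : ℕ) : Type := lp (fun _ : Freq d => ℂ) 2

/-- `v ∈ H^s_per`, for a family `v` of Fourier coefficients. -/
def MemHs {d : ℕ} (L s : ℝ) (v : Freq d → ℂ) : Prop :=
  Summable fun n => (1 + kSq L n) ^ s * ‖v n‖ ^ 2

/-- The Fourier coefficients of the product `V u`. Here `V n` is the coefficient of
`exp(i k_n · x)` in the potential `V` (so `⟨e_m, V e_n⟩ = V (m - n)`), and `u n` is the coefficient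
of `e_n` in `u`. -/
def mulPot {d : ℕ} (V u : Freq d → ℂ) (n : Freq d) : ℂ :=
  ∑' m, V (n - m) * u m

/-- The potential `V` is real valued. -/
def IsRealPot {d : ℕ} (V : Freq d → ℂ) : Prop :=
  ∀ n, V (-n) = (starRingEnd ℂ) (V n)

/-- The norm on `ℓ²(ι)` of the operator with the (infinite) matrix `B`: the supremum of `‖B x‖` over
the finitely supported `x` with `‖x‖ ≤ 1`. It is `⊤` if `B` does not define a bounded operator. -/
def matrixOpNorm {ι : Type*} (B : ι → ι → ℂ) : ENNReal :=
  ⨆ (x : ι →₀ ℂ) (_ : x.sum (fun _ a => ‖a‖ ^ 2) ≤ 1),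
    (∑' k, ‖x.sum (fun l a => B k l * a)‖ₑ ^ 2) ^ (1 / 2 : ℝ)

/-- `‖V‖_r = ‖(-Δ + 1)^(-1/2 + r/2) V (-Δ + 1)^(-1/2 + r/2)‖`, the norm of operators on `L²_per`. -/
def potNorm {d : ℕ} (L r : ℝ) (V : Freq d → ℂ) : ENNReal :=
  matrixOpNorm fun k l : Freq d =>
    (((1 + kSq L k) ^ (-1 / 2 + r / 2) : ℝ) : ℂ) * V (k - l) *
      (((1 + kSq L l) ^ (-1 / 2 + r / 2) : ℝ) : ℂ)

/-- `ρ_M = (2πM/L)²`. -/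
def rho (L : ℝ) (M : ℕ) : ℝ := (2 * Real.pi * M / L) ^ 2

/-- `κ_M = ρ_M - (ρ_M + 1) ρ_M^(-r) ‖V‖_r`. -/
def kappa {d : ℕ} (L r : ℝ) (V : Freq d → ℂ) (M : ℕ) : ℝ :=
  rho L M - (rho L M + 1) * rho L M ^ (-r) * (potNorm L r V).toReal

/-- `X_M` is spanned by the plane waves whose `-Δ`-eigenvalue is smaller than `ρ_M`. -/
def IsLow {d : ℕ} (L : ℝ) (M : ℕ) (n : Freq d) : Prop := kSq L n < rho L M

/-- The index set of the plane-wave basis of `X_M`. -/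
abbrev Low (d : ℕ) (L : ℝ) (M : ℕ) : Type := {n : Freq d // IsLow L M n}

theorem finite_low (d : ℕ) (L : ℝ) (M : ℕ) : Finite (Low d L M) := by
  have hsub : {n : Freq d | IsLow L M n} ⊆ Set.pi Set.univ fun _ => Set.Icc (-(M : ℤ)) M := by
    intro n hn j _
    have hn' : kSq L n < rho L M := hn
    have h1 : (2 * Real.pi / L) ^ 2 * ∑ j, (n j : ℝ) ^ 2 < (2 * Real.pi / L) ^ 2 * (M : ℝ) ^ 2 := by
      have e : rho L M = (2 * Real.pi / L) ^ 2 * (M : ℝ) ^ 2 := by unfold rho; ring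
      rw [← e]; exact hn'
    have h2 : ∑ j, (n j : ℝ) ^ 2 < (M : ℝ) ^ 2 := lt_of_mul_lt_mul_left h1 (sq_nonneg _)
    have h3 : (n j : ℝ) ^ 2 ≤ ∑ j, (n j : ℝ) ^ 2 :=
      Finset.single_le_sum (f := fun j => (n j : ℝ) ^ 2) (fun i _ => sq_nonneg _)
        (Finset.mem_univ j)
    have h4 : |(n j : ℝ)| ≤ (M : ℝ) := abs_le_of_sq_le_sq (h3.trans h2.le) (Nat.cast_nonneg M)
    obtain ⟨h5, h6⟩ := abs_le.mp h4
    exact ⟨by exact_mod_cast h5, by exact_mod_cast h6⟩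
  exact ((Set.Finite.pi' fun _ => Set.finite_Icc _ _).subset
    (fun n hn j => hsub hn j (Set.mem_univ j))).to_subtype

instance (d : ℕ) (L : ℝ) (M : ℕ) : Fintype (Low d L M) :=
  @Fintype.ofFinite _ (finite_low d L M)

/-- `φ ∈ H¹_per` solves `(-Δ + V) φ = μ φ` weakly, tested against all plane waves. -/
def IsWeakEigen {d : ℕ} (L : ℝ) (V : Freq d → ℂ) (μ : ℝ) (φ : L2per d) : Prop :=
  MemHs L 1 (φ : Freq d → ℂ) ∧
    ∀ n, (kSq L n : ℂ) * φ n + mulPot V φ n = (μ : ℂ) * φ n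

/-- The span of all eigenfunctions of `-Δ + V` whose eigenvalue lies in `I`. -/
def eigenSpan {d : ℕ} (L : ℝ) (V : Freq d → ℂ) (I : Set ℝ) : Submodule ℂ (L2per d) :=
  Submodule.span ℂ {φ | ∃ μ ∈ I, IsWeakEigen L V μ φ}

/-- `μ` is the eigenvalue number `i` of `-Δ + V` on `L²_per`, where `i` counts from `0`, in increasing
order and with multiplicity: at most `i` eigenvalues are smaller than `μ`, and at least
`i + 1` are at most `μ`. -/
def IsNthEigenvalue {d : ℕ} (L : ℝ) (V : Freq d → ℂ) (i : ℕ) (μ : ℝ) : Prop :=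
  Module.rank ℂ (eigenSpan L V (Set.Iio μ)) ≤ (i : Cardinal) ∧
    ((i + 1 : ℕ) : Cardinal) ≤ Module.rank ℂ (eigenSpan L V (Set.Iic μ))

/-- `w ∈ H¹_per ∩ Ran P_M^⊥` solves `(H_M^⊥ - lam) w = P_M^⊥ f`, where
`H_M^⊥ = P_M^⊥ (-Δ + V) P_M^⊥`. -/
def IsPerpSolution {d : ℕ} (L : ℝ) (V : Freq d → ℂ) (M : ℕ) (lam : ℝ) (f w : Freq d → ℂ) : Prop :=
  MemHs L 1 w ∧ (∀ n, IsLow L M n → w n = 0) ∧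
    ∀ n, ¬ IsLow L M n → (kSq L n : ℂ) * w n + mulPot V w n - (lam : ℂ) * w n = f n

/-- `H_M^⊥ - lam` is invertible on `Ran P_M^⊥`, as a map from `H¹_per` to `H⁻¹_per`. -/
def PerpInvertible {d : ℕ} (L : ℝ) (V : Freq d → ℂ) (M : ℕ) (lam : ℝ) : Prop :=
  ∀ f : Freq d → ℂ, MemHs L (-1) f → ∃! w, IsPerpSolution L V M lam f w

open Classical in
/-- `P_M^⊥ (H_M^⊥ - lam)⁻¹ P_M^⊥ f`; by convention `0` if the equation has no solution. -/
def perpResolvent {d : ℕ} (L : ℝ) (V : Freq d → ℂ) (M : ℕ) (lam : ℝ) (f : Freq d → ℂ) :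
    Freq d → ℂ :=
  if h : ∃ w, IsPerpSolution L V M lam f w then h.choose else 0

/-- The matrix of the Galerkin Hamiltonian `H_M = P_M (-Δ + V) P_M` in the plane-wave basis of
`X_M`. -/
def galerkin {d : ℕ} (L : ℝ) (V : Freq d → ℂ) (M : ℕ) : Matrix (Low d L M) (Low d L M) ℂ :=
  Matrix.of fun k l => (if k = l then (kSq L k.1 : ℂ) else 0) + V (k.1 - l.1)

/-- The matrix of the effective interaction
`U_M(lam) = - P_M V P_M^⊥ (H_M^⊥ - lam)⁻¹ P_M^⊥ V P_M` in the plane-wave basis of `X_M`.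
The Fourier coefficients of `V e_l` are `n ↦ V (n - l)`. -/
def effInteraction {d : ℕ} (L : ℝ) (V : Freq d → ℂ) (M : ℕ) (lam : ℝ) :
    Matrix (Low d L M) (Low d L M) ℂ :=
  Matrix.of fun k l => - mulPot V (perpResolvent L V M lam fun n => V (n - l.1)) k.1

/-- `H_M(lam) = H_M + U_M(lam)` on `X_M`. -/
def effHamiltonian {d : ℕ} (L : ℝ) (V : Freq d → ℂ) (M : ℕ) (lam : ℝ) :
    Matrix (Low d L M) (Low d L M) ℂ :=
  galerkin L V M + effInteraction L V M lam

open Classical in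
/-- The eigenvalue number `i` of `H_M(lam)`, where `i` counts from `0`, in increasing order and with
multiplicity (`eigenvalues₀` is in decreasing order, hence `i.rev`). By convention `0` if `H_M(lam)`
is not Hermitian. -/
def nu {d : ℕ} (L : ℝ) (V : Freq d → ℂ) (M : ℕ) (i : Fin (Fintype.card (Low d L M)))
    (lam : ℝ) : ℝ :=
  if h : (effHamiltonian L V M lam).IsHermitian then h.eigenvalues₀ i.rev else 0

end FeshbachSchur

end

/-! Conjugation with (-Δ+1)^(1/2) turns -Δ + V - t into a pencil A - tG of bounded symmetric
operators on ℓ², with G = (-Δ+1)⁻¹. On the high modes G is at most (1+ρ_M)⁻¹, and the conjugated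
potential is at least -‖V‖_r (1+ρ_M)^(-r). Hence the high block is coercive for t < κ_M, uniformly
on each half-line t ≤ b with b < κ_M (`exists_coercive`). Lax-Milgram inverts it, and H_M(t) - t
becomes the Schur complement of A - tG (`effHamiltonian_apply`).

The form of a Schur complement at a low x is the minimum of the full form at x + y over high y
(`IsCompressedInverse.inner_schur_le`). As G commutes with the projection, the form of H_M(t) is the
minimum over y of ⟨x+y, A(x+y)⟩ - t⟨y, Gy⟩. For fixed y this decreases in t, and a bound on the
minimizer makes the minimum Lipschitz in t. By Courant-Fischer each ν_Mi is antitone and continuous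
on such half-lines, so ν_Mi(λ) = λ has at most one solution.

For existence, let μ < κ_M be the i-th eigenvalue. On the span of the eigenfunctions with eigenvalue
at most μ the form of A - μG is nonpositive. Coercivity makes the projection of this span to X_M
injective, and the minimum property carries the sign over to H_M(μ) - μ. So ν_Mi(μ) ≤ μ
(`nu_le_of_rank_le`), and the intermediate value theorem gives a fixed point. -/

/-! ### Courant-Fischer and Weyl principles for Hermitian matrices -/

namespace LinearMap.IsSymmetric

open Module

variable {𝕜 E : Type*} [RCLike 𝕜] [NormedAddCommGroup E] [InnerProductSpace 𝕜 E]
  [FiniteDimensional 𝕜 E] {T : E →ₗ[𝕜] E} {n : ℕ}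

/-- The quadratic form of a symmetric operator, in an eigenbasis. -/
theorem re_inner_eq_sum_eigenvalues (hT : T.IsSymmetric) (hn : finrank 𝕜 E = n) (x : E) :
    RCLike.re (inner 𝕜 x (T x)) =
      ∑ k, hT.eigenvalues hn k * ‖inner 𝕜 (hT.eigenvectorBasis hn k) x‖ ^ 2 := by
  rw [← (hT.eigenvectorBasis hn).sum_inner_mul_inner x (T x), map_sum]
  refine Finset.sum_congr rfl fun k _ => ?_
  rw [← hT, hT.apply_eigenvectorBasis, inner_smul_left, RCLike.conj_ofReal, mul_left_comm,
    RCLike.re_ofReal_mul, ← inner_conj_symm x, RCLike.conj_mul]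
  norm_cast

/-- An upper bound for the quadratic form on a large subspace bounds an eigenvalue from above
(one half of the Courant-Fischer principle). -/
theorem eigenvalues_le_of_forall_mem (hT : T.IsSymmetric) (hn : finrank 𝕜 E = n) (j : Fin n)
    {t : ℝ} (W : Submodule 𝕜 E) (hW : n ≤ finrank 𝕜 W + j)
    (h : ∀ x ∈ W, RCLike.re (inner 𝕜 x (T x)) ≤ t * ‖x‖ ^ 2) :
    hT.eigenvalues hn j ≤ t := by
  set b := hT.eigenvectorBasis hn
  -- Eigenvalues are in decreasing order, so the form is at least the `j`-th eigenvalue on `S`.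
  -- Since dim `S` = `j + 1` and dim `W` ≥ `n - j`, the two spaces share a nonzero vector.
  let S : Submodule 𝕜 E := Submodule.span 𝕜 (Set.range fun k : Set.Iic j => b k)
  have hS : finrank 𝕜 S = j + 1 := by
    have := finrank_span_eq_card (R := 𝕜) (b := fun k : Set.Iic j => b k)
      (b.orthonormal.linearIndependent.comp _ Subtype.val_injective)
    rw [this]
    simp
  have hSk : ∀ x ∈ S, ∀ k, j < k → inner 𝕜 (b k) x = 0 := by
    intro x hx k hk
    induction hx using Submodule.span_induction with
    | mem x hx =>
      obtain ⟨l, rfl⟩ := hx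
      exact b.orthonormal.2 (ne_of_gt (lt_of_le_of_lt l.2 hk))
    | zero => simp
    | add x y _ _ hx hy => rw [inner_add_right, hx, hy, add_zero]
    | smul a x _ hx => rw [inner_smul_right, hx, mul_zero]
  have hdim : 0 < finrank 𝕜 (W ⊓ S : Submodule 𝕜 E) := by
    have h1 := Submodule.finrank_sup_add_finrank_inf_eq W S
    have h2 := Submodule.finrank_le (W ⊔ S)
    omega
  obtain ⟨x, hx0⟩ := finrank_pos_iff_exists_ne_zero.mp hdim
  have hx0' : (x : E) ≠ 0 := fun h => hx0 (Subtype.ext h)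
  have hpos : 0 < ‖(x : E)‖ ^ 2 := by positivity
  refine le_of_mul_le_mul_right (le_trans ?_ (h x x.2.1)) hpos
  rw [hT.re_inner_eq_sum_eigenvalues hn, ← b.sum_sq_norm_inner_right (x : E), Finset.mul_sum]
  refine Finset.sum_le_sum fun k _ => ?_
  rcases lt_or_ge j k with hk | hk
  · simp [b, hSk x x.2.2 k hk]
  · exact mul_le_mul_of_nonneg_right (hT.eigenvalues_antitone hn hk) (sq_nonneg _)

/-- The quadratic form is at most the `j`-th eigenvalue on the span of the eigenvectors of the
eigenvalues number `j`, `j + 1`, … (the other half of the Courant-Fischer principle). -/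
theorem exists_forall_mem_le_eigenvalues (hT : T.IsSymmetric) (hn : finrank 𝕜 E = n)
    (j : Fin n) :
    ∃ W : Submodule 𝕜 E, n ≤ finrank 𝕜 W + j ∧
      ∀ x ∈ W, RCLike.re (inner 𝕜 x (T x)) ≤ hT.eigenvalues hn j * ‖x‖ ^ 2 := by
  set b := hT.eigenvectorBasis hn
  refine ⟨Submodule.span 𝕜 (Set.range fun k : Set.Ici j => b k), ?_, fun x hx => ?_⟩
  · have := finrank_span_eq_card (R := 𝕜) (b := fun k : Set.Ici j => b k)
      (b.orthonormal.linearIndependent.comp _ Subtype.val_injective)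
    rw [this]
    simp
  · have hSk : ∀ k, k < j → inner 𝕜 (b k) x = 0 := by
      intro k hk
      induction hx using Submodule.span_induction with
      | mem x hx =>
        obtain ⟨l, rfl⟩ := hx
        exact b.orthonormal.2 (ne_of_lt (lt_of_lt_of_le hk l.2))
      | zero => simp
      | add x y _ _ hx hy => rw [inner_add_right, hx, hy, add_zero]
      | smul a x _ hx => rw [inner_smul_right, hx, mul_zero]
    rw [hT.re_inner_eq_sum_eigenvalues hn, ← b.sum_sq_norm_inner_right x, Finset.mul_sum]
    refine Finset.sum_le_sum fun k _ => ?_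
    rcases lt_or_ge k j with hk | hk
    · simp [b, hSk k hk]
    · exact mul_le_mul_of_nonneg_right (hT.eigenvalues_antitone hn hk) (sq_nonneg _)

end LinearMap.IsSymmetric

namespace Matrix.IsHermitian

open _root_.Module

variable {n : Type*} [Fintype n] [DecidableEq n] {A B : Matrix n n ℂ}

/-- Upper bounds for the quadratic form on an `(i + 1)`-dimensional space bound the eigenvalue
number `i`, counted from `0` in increasing order. -/
theorem eigenvalues₀_rev_le (hA : A.IsHermitian) (i : Fin (Fintype.card n)) {t : ℝ}
    (W : Submodule ℂ (EuclideanSpace ℂ n)) (hW : (i : ℕ) + 1 ≤ finrank ℂ W)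
    (h : ∀ x ∈ W, (inner ℂ x (A.toEuclideanLin x)).re ≤ t * ‖x‖ ^ 2) :
    hA.eigenvalues₀ i.rev ≤ t :=
  (isSymmetric_toEuclideanLin_iff.mpr hA).eigenvalues_le_of_forall_mem finrank_euclideanSpace
    i.rev W (by rw [Fin.val_rev]; omega) h

/-- The eigenvectors of the `i + 1` lowest eigenvalues span such a space; it is the trial space when
two matrices are compared. -/
theorem exists_le_eigenvalues₀_rev (hA : A.IsHermitian) (i : Fin (Fintype.card n)) :
    ∃ W : Submodule ℂ (EuclideanSpace ℂ n), (i : ℕ) + 1 ≤ finrank ℂ W ∧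
      ∀ x ∈ W, (inner ℂ x (A.toEuclideanLin x)).re ≤ hA.eigenvalues₀ i.rev * ‖x‖ ^ 2 := by
  obtain ⟨W, hW, h⟩ := (isSymmetric_toEuclideanLin_iff.mpr hA).exists_forall_mem_le_eigenvalues
    finrank_euclideanSpace i.rev
  exact ⟨W, by rw [Fin.val_rev] at hW; omega, h⟩

/-- Weyl's monotonicity principle, with an error term. -/
theorem eigenvalues₀_rev_le_add (hA : A.IsHermitian) (hB : B.IsHermitian)
    (i : Fin (Fintype.card n)) {c : ℝ}
    (h : ∀ x, (inner ℂ x (A.toEuclideanLin x)).re ≤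
      (inner ℂ x (B.toEuclideanLin x)).re + c * ‖x‖ ^ 2) :
    hA.eigenvalues₀ i.rev ≤ hB.eigenvalues₀ i.rev + c := by
  obtain ⟨W, hW, hle⟩ := hB.exists_le_eigenvalues₀_rev i
  refine hA.eigenvalues₀_rev_le i W hW fun x hx => ?_
  linarith [h x, hle x hx, add_mul (hB.eigenvalues₀ i.rev) c (‖x‖ ^ 2)]

end Matrix.IsHermitian

/-! ### Schur complements and their variational principle -/

namespace FeshbachSchur

section Schur

variable {E : Type*} [NormedAddCommGroup E] [InnerProductSpace ℂ E]

/-- `R` inverts the compression `Q A Q` on the range of the projection `Q`, and maps into that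
range. -/
structure IsCompressedInverse (Q A R : E →L[ℂ] E) : Prop where
  proj_apply : ∀ f, Q (R f) = R f
  proj_apply_apply : ∀ f, Q (A (R f)) = Q f

/-- The Schur complement of the block of `A` on the range of a projection, where `R` is the inverse
of that block. -/
def schur (A R : E →L[ℂ] E) : E →L[ℂ] E := A - A.comp (R.comp A)

variable {Q A R : E →L[ℂ] E}

/-- Inserting `Q` and replacing `Q g` by `Q A R g` brings both pairings to the form ⟨R f, A R g⟩. -/
theorem IsCompressedInverse.isSymmetric (hR : IsCompressedInverse Q A R)
    (hQ : (Q : E →ₗ[ℂ] E).IsSymmetric) (hA : (A : E →ₗ[ℂ] E).IsSymmetric) :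
    (R : E →ₗ[ℂ] E).IsSymmetric := by
  intro f g
  simp only [ContinuousLinearMap.coe_coe]
  have hQ' : ∀ x y, inner ℂ (Q x) y = inner ℂ x (Q y) := hQ
  have hA' : ∀ x y, inner ℂ (A x) y = inner ℂ x (A y) := hA
  rw [← hR.proj_apply f, hQ', ← hR.proj_apply_apply g, ← hQ', hR.proj_apply, ← hA',
    ← hR.proj_apply g, ← hQ', hR.proj_apply_apply, hQ']

theorem isSymmetric_schur (hA : (A : E →ₗ[ℂ] E).IsSymmetric) (hR : (R : E →ₗ[ℂ] E).IsSymmetric) :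
    (schur A R : E →ₗ[ℂ] E).IsSymmetric := by
  intro f g
  have hR' : ∀ x y, inner ℂ (R x) y = inner ℂ x (R y) := hR
  have hA' : ∀ x y, inner ℂ (A x) y = inner ℂ x (A y) := hA
  simp [schur, inner_sub_left, inner_sub_right, hA', hR']

/-- A coercive block of a bounded symmetric operator has an inverse (Lax-Milgram). -/
theorem exists_isCompressedInverse [CompleteSpace E] (hQ : (Q : E →ₗ[ℂ] E).IsSymmetric)
    (hQQ : ∀ x, Q (Q x) = Q x) {δ : ℝ} (hδ : 0 < δ)
    (hA : ∀ x, Q x = x → δ * ‖x‖ ^ 2 ≤ (inner ℂ x (A x)).re) :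
    ∃ R, IsCompressedInverse Q A R := by
  have hQ' : ∀ x y, inner ℂ (Q x) y = inner ℂ x (Q y) := hQ
  -- Adding the identity on the complement of the range makes the compressed block coercive on all
  -- of `E`, with constant `min δ 1`.
  set T : E →L[ℂ] E := Q.comp (A.comp Q) + (1 - Q) with hT
  have hc : 0 < min δ 1 := lt_min hδ one_pos
  have hpyth : ∀ x, ‖x‖ ^ 2 = ‖Q x‖ ^ 2 + ‖x - Q x‖ ^ 2 := by
    intro x
    have h0 : inner ℂ (Q x) (x - Q x) = 0 := by rw [hQ', map_sub, hQQ, sub_self, inner_zero_right]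
    have := norm_add_sq_eq_norm_sq_add_norm_sq_of_inner_eq_zero (Q x) (x - Q x) h0
    rw [add_sub_cancel] at this
    nlinarith
  have hunit : IsUnit T := by
    refine ContinuousLinearMap.isUnit_of_forall_le_norm_inner_map T (c := ⟨min δ 1, hc.le⟩) hc
      fun x => ?_
    have h1 : inner ℂ (T x) x = inner ℂ (A (Q x)) (Q x) + inner ℂ (x - Q x) (x - Q x) := by
      have : inner ℂ (x - Q x) (Q x) = 0 := by
        rw [← hQ', map_sub, hQQ, sub_self, inner_zero_left]
      rw [inner_sub_right (x - Q x) x, this, hT]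
      simp [inner_sub_left, hQ']
    have h2 : (inner ℂ (T x) x).re = (inner ℂ (Q x) (A (Q x))).re + ‖x - Q x‖ ^ 2 := by
      rw [h1, Complex.add_re, inner_self_eq_norm_sq_to_K, ← inner_conj_symm, Complex.conj_re]
      norm_cast
    refine le_trans ?_ (Complex.re_le_norm _)
    rw [h2, hpyth x]
    have h3 := hA (Q x) (hQQ x)
    change (‖Q x‖ ^ 2 + ‖x - Q x‖ ^ 2) * min δ 1 ≤ _
    nlinarith [min_le_left δ 1, min_le_right δ 1, sq_nonneg ‖Q x‖, sq_nonneg ‖x - Q x‖]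
  obtain ⟨u, hu⟩ := hunit
  have hinv : ∀ f, T ((↑u⁻¹ : E →L[ℂ] E) f) = f := fun f => by
    rw [← hu, ← mul_apply_eq_comp, u.mul_inv, one_apply_eq_self]
  -- With `y = T⁻¹ Q f`, applying `Q` to `T y = Q f` leaves `Q A Q y = Q f`; comparison with the
  -- original equation gives `y = Q y`.
  have key : ∀ f, Q ((↑u⁻¹ : E →L[ℂ] E) (Q f)) = (↑u⁻¹ : E →L[ℂ] E) (Q f) ∧
      Q (A (Q ((↑u⁻¹ : E →L[ℂ] E) (Q f)))) = Q f := by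
    intro f
    set y := (↑u⁻¹ : E →L[ℂ] E) (Q f)
    have h1 : Q (A (Q y)) + (y - Q y) = Q f := by
      have := hinv (Q f)
      simpa [hT] using this
    have h2 := congrArg Q h1
    simp only [map_add, map_sub, hQQ, sub_self, add_zero] at h2
    refine ⟨?_, h2⟩
    rw [h2, add_eq_left, sub_eq_zero] at h1
    exact h1.symm
  exact ⟨(↑u⁻¹ : E →L[ℂ] E).comp Q, ⟨fun f => (key f).1, fun f => by
    have := (key f).2
    rwa [(key f).1] at this⟩⟩

/-- The difference of two solutions lies in the range of `Q` and has zero form, so coercivity kills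
it. This later identifies `R` with the weak solution operator. -/
theorem IsCompressedInverse.eq_of_coercive (hR : IsCompressedInverse Q A R)
    (hQ : (Q : E →ₗ[ℂ] E).IsSymmetric) {δ : ℝ} (hδ : 0 < δ)
    (hA : ∀ x, Q x = x → δ * ‖x‖ ^ 2 ≤ (inner ℂ x (A x)).re) {w f : E} (hw : Q w = w)
    (hwf : Q (A w) = Q f) : w = R f := by
  have hQ' : ∀ x y, inner ℂ (Q x) y = inner ℂ x (Q y) := hQ
  have h1 : Q (w - R f) = w - R f := by rw [map_sub, hw, hR.proj_apply]
  have h2 : inner ℂ (w - R f) (A (w - R f)) = 0 := by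
    rw [← h1, hQ', h1, map_sub A, map_sub Q, hwf, hR.proj_apply_apply, sub_self, inner_zero_right]
  have h3 := hA _ h1
  rw [h2, Complex.zero_re] at h3
  have h4 : ‖w - R f‖ ^ 2 = 0 := le_antisymm (by nlinarith [sq_nonneg ‖w - R f‖]) (sq_nonneg _)
  exact sub_eq_zero.mp (norm_eq_zero.mp (pow_eq_zero_iff two_ne_zero |>.mp h4))

/-- A priori estimate: test the equation with its solution `R f`. -/
theorem IsCompressedInverse.norm_le (hR : IsCompressedInverse Q A R)
    (hQ : (Q : E →ₗ[ℂ] E).IsSymmetric) {δ : ℝ}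
    (hA : ∀ x, Q x = x → δ * ‖x‖ ^ 2 ≤ (inner ℂ x (A x)).re) (f : E) :
    δ * ‖R f‖ ≤ ‖Q f‖ := by
  have hQ' : ∀ x y, inner ℂ (Q x) y = inner ℂ x (Q y) := hQ
  have h1 := hA _ (hR.proj_apply f)
  have h2 : inner ℂ (R f) (A (R f)) = inner ℂ (R f) (Q f) := by
    rw [← hR.proj_apply_apply, ← hQ', hR.proj_apply]
  rw [h2] at h1
  have h3 : (inner ℂ (R f) (Q f)).re ≤ ‖R f‖ * ‖Q f‖ :=
    (Complex.re_le_norm _).trans (norm_inner_le_norm _ _)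
  rcases (norm_nonneg (R f)).eq_or_lt with h0 | h0
  · rw [← h0, mul_zero]; exact norm_nonneg _
  · refine le_of_mul_le_mul_left ?_ h0
    nlinarith

/-- The form of the Schur complement is the value of the full form at the stationary point. -/
theorem IsCompressedInverse.inner_schur_eq (hR : IsCompressedInverse Q A R)
    (hQ : (Q : E →ₗ[ℂ] E).IsSymmetric) (x : E) :
    inner ℂ (x - R (A x)) (A (x - R (A x))) = inner ℂ x (schur A R x) := by
  have hQ' : ∀ x y, inner ℂ (Q x) y = inner ℂ x (Q y) := hQ
  -- Stationarity: `Q A (x - R A x) = 0`, and `R (A x)` lies in the range of `Q`.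
  have h : inner ℂ (R (A x)) (A (x - R (A x))) = 0 := by
    rw [← hR.proj_apply, hQ', hR.proj_apply, map_sub, map_sub, hR.proj_apply_apply, sub_self,
      inner_zero_right]
  rw [inner_sub_left, h, sub_zero, schur]
  simp [inner_sub_right]

/-- The form of the Schur complement is a minimum of the full form. -/
theorem IsCompressedInverse.inner_schur_le (hR : IsCompressedInverse Q A R)
    (hQ : (Q : E →ₗ[ℂ] E).IsSymmetric) (hAs : (A : E →ₗ[ℂ] E).IsSymmetric)
    (hA : ∀ x, Q x = x → 0 ≤ (inner ℂ x (A x)).re) {y : E} (x : E) (hy : Q y = y) :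
    (inner ℂ x (schur A R x)).re ≤ (inner ℂ (x + y) (A (x + y))).re := by
  have hQ' : ∀ x y, inner ℂ (Q x) y = inner ℂ x (Q y) := hQ
  have hA' : ∀ x y, inner ℂ (A x) y = inner ℂ x (A y) := hAs
  -- Here `z` is the stationary point and `v` the deviation from it. The cross terms vanish, so the
  -- excess over the minimum is the form at `v`.
  set z := x - R (A x) with hz
  set v := y + R (A x) with hv
  have hQv : Q v = v := by rw [hv, map_add, hy, hR.proj_apply]
  have hxy : x + y = z + v := by rw [hz, hv]; abel
  have h1 : inner ℂ v (A z) = 0 := by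
    rw [← hQv, hQ', hz, map_sub, map_sub, hR.proj_apply_apply, sub_self, inner_zero_right]
  have h2 : inner ℂ z (A v) = 0 := by
    rw [← hA', ← inner_conj_symm, h1, map_zero]
  rw [← hR.inner_schur_eq hQ, ← hz, hxy, map_add, inner_add_left, inner_add_right,
    inner_add_right, h1, h2, add_zero, zero_add, Complex.add_re]
  linarith [hA v hQv]

end Schur

/-! ### Dependence of the effective form on the spectral parameter -/

section Pencil

variable {E : Type*} [NormedAddCommGroup E] [InnerProductSpace ℂ E] {Q A G R₁ R₂ : E →L[ℂ] E}

theorem isSymmetric_sub_smul (hA : (A : E →ₗ[ℂ] E).IsSymmetric)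
    (hG : (G : E →ₗ[ℂ] E).IsSymmetric) (t : ℝ) :
    ((A - (t : ℂ) • G : E →L[ℂ] E) : E →ₗ[ℂ] E).IsSymmetric := by
  intro x y
  have hG' : ∀ x y, inner ℂ (G x) y = inner ℂ x (G y) := hG
  have hA' : ∀ x y, inner ℂ (A x) y = inner ℂ x (A y) := hA
  simp [-Complex.coe_smul, inner_sub_left, inner_sub_right, hG', hA', inner_smul_left,
    inner_smul_right]

theorem re_inner_sub_smul (t : ℝ) (x : E) :
    (inner ℂ x ((A - (t : ℂ) • G) x)).re = (inner ℂ x (A x)).re - t * (inner ℂ x (G x)).re := by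
  rw [sub_apply, smul_apply, inner_sub_right, inner_smul_right, Complex.sub_re,
    Complex.re_ofReal_mul]

/-- Without cross terms in `G`, adding `t⟨x, G x⟩` to the form of `A - t G` at `x + y` leaves `t`
only in `-t⟨y, G y⟩`. -/
theorem re_inner_add_of_commute (hQ : (Q : E →ₗ[ℂ] E).IsSymmetric) (hQG : ∀ x, Q (G x) = G (Q x))
    {x y : E} (hx : Q x = 0) (hy : Q y = y) :
    (inner ℂ (x + y) (G (x + y))).re = (inner ℂ x (G x)).re + (inner ℂ y (G y)).re := by
  have hQ' : ∀ x y, inner ℂ (Q x) y = inner ℂ x (Q y) := hQ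
  have h1 : inner ℂ y (G x) = 0 := by rw [← hy, hQ', hQG, hx, map_zero, inner_zero_right]
  have h2 : inner ℂ x (G y) = 0 := by rw [← hy, ← hQG, ← hQ', hx, inner_zero_left]
  rw [map_add, inner_add_left, inner_add_right, inner_add_right, h1, h2, add_zero, zero_add,
    Complex.add_re]

/-- The effective form `⟨x, S(t) x⟩ + t ⟨x, G x⟩` of the pencil `A - t G` is antitone in the spectral
parameter `t`. -/
theorem effective_form_antitone (hQ : (Q : E →ₗ[ℂ] E).IsSymmetric)
    (hA : (A : E →ₗ[ℂ] E).IsSymmetric) (hG : (G : E →ₗ[ℂ] E).IsSymmetric)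
    (hQG : ∀ x, Q (G x) = G (Q x)) (hG0 : ∀ x, 0 ≤ (inner ℂ x (G x)).re) {t₁ t₂ : ℝ}
    (h₁ : IsCompressedInverse Q (A - (t₁ : ℂ) • G) R₁)
    (h₂ : IsCompressedInverse Q (A - (t₂ : ℂ) • G) R₂)
    (hc : ∀ x, Q x = x → 0 ≤ (inner ℂ x ((A - (t₂ : ℂ) • G) x)).re) (ht : t₁ ≤ t₂) {x : E}
    (hx : Q x = 0) :
    (inner ℂ x (schur (A - (t₂ : ℂ) • G) R₂ x)).re + t₂ * (inner ℂ x (G x)).re ≤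
      (inner ℂ x (schur (A - (t₁ : ℂ) • G) R₁ x)).re + t₁ * (inner ℂ x (G x)).re := by
  -- The minimizer for `t₁` is a competitor for `t₂`, where its value is lower by `(t₂ - t₁)⟨y, G
  -- y⟩`.
  set y := -R₁ ((A - (t₁ : ℂ) • G) x) with hy
  have hQy : Q y = y := by rw [hy, map_neg, h₁.proj_apply]
  have e₂ := h₂.inner_schur_le hQ (isSymmetric_sub_smul hA hG t₂) hc x hQy
  have e₁ := congrArg Complex.re (h₁.inner_schur_eq hQ x)
  rw [sub_eq_add_neg, ← hy] at e₁
  rw [← e₁]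
  rw [re_inner_sub_smul, re_inner_add_of_commute hQ hQG hx hQy] at e₂ ⊢
  nlinarith [hG0 y, mul_nonneg (sub_nonneg.mpr ht) (hG0 y)]

/-- The effective form is Lipschitz continuous in the spectral parameter. -/
theorem effective_form_le_add (hQ : (Q : E →ₗ[ℂ] E).IsSymmetric)
    (hA : (A : E →ₗ[ℂ] E).IsSymmetric) (hG : (G : E →ₗ[ℂ] E).IsSymmetric)
    (hQG : ∀ x, Q (G x) = G (Q x)) {t₁ t₂ δ : ℝ} (hδ : 0 < δ)
    (h₁ : IsCompressedInverse Q (A - (t₁ : ℂ) • G) R₁)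
    (h₂ : IsCompressedInverse Q (A - (t₂ : ℂ) • G) R₂)
    (hc₁ : ∀ x, Q x = x → 0 ≤ (inner ℂ x ((A - (t₁ : ℂ) • G) x)).re)
    (hc₂ : ∀ x, Q x = x → δ * ‖x‖ ^ 2 ≤ (inner ℂ x ((A - (t₂ : ℂ) • G) x)).re) (ht : t₁ ≤ t₂)
    {x : E} (hx : Q x = 0) :
    (inner ℂ x (schur (A - (t₁ : ℂ) • G) R₁ x)).re + t₁ * (inner ℂ x (G x)).re ≤
      (inner ℂ x (schur (A - (t₂ : ℂ) • G) R₂ x)).re + t₂ * (inner ℂ x (G x)).re +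
        (t₂ - t₁) * (‖G‖ * (‖Q.comp A‖ / δ) ^ 2 * ‖x‖ ^ 2) := by
  -- Now the minimizer for `t₂` competes at `t₁`, and the cost `(t₂ - t₁)⟨y, G y⟩` has to be
  -- bounded.
  set y := -R₂ ((A - (t₂ : ℂ) • G) x) with hy
  have hQy : Q y = y := by rw [hy, map_neg, h₂.proj_apply]
  have e₁ := h₁.inner_schur_le hQ (isSymmetric_sub_smul hA hG t₁) hc₁ x hQy
  have e₂ := congrArg Complex.re (h₂.inner_schur_eq hQ x)
  rw [sub_eq_add_neg, ← hy] at e₂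
  rw [← e₂]
  rw [re_inner_sub_smul, re_inner_add_of_commute hQ hQG hx hQy] at e₁ ⊢
  have hy1 : ‖y‖ ≤ ‖Q.comp A‖ / δ * ‖x‖ := by
    have h := h₂.norm_le hQ hc₂ ((A - (t₂ : ℂ) • G) x)
    -- The `G` term drops out since `Q G x = G Q x = 0`, so the bound on `y` depends on `t₂` only
    -- through `δ`.
    have h' : Q ((A - (t₂ : ℂ) • G) x) = Q.comp A x := by simp [hQG, hx]
    rw [h'] at h
    have h'' := (Q.comp A).le_opNorm x
    rw [hy, norm_neg, div_mul_eq_mul_div, le_div_iff₀ hδ]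
    linarith
  have hy2 : (inner ℂ y (G y)).re ≤ ‖G‖ * (‖Q.comp A‖ / δ) ^ 2 * ‖x‖ ^ 2 := by
    calc (inner ℂ y (G y)).re ≤ ‖y‖ * ‖G y‖ :=
          (Complex.re_le_norm _).trans (norm_inner_le_norm _ _)
      _ ≤ ‖y‖ * (‖G‖ * ‖y‖) := by gcongr; exact G.le_opNorm y
      _ = ‖G‖ * ‖y‖ ^ 2 := by ring
      _ ≤ ‖G‖ * (‖Q.comp A‖ / δ * ‖x‖) ^ 2 := by gcongr
      _ = _ := by ring
  nlinarith [mul_le_mul_of_nonneg_left hy2 (sub_nonneg.mpr ht)]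

/-- On the span of the solutions of `A z = ν G z` with `ν ≤ μ`, the form of `A - μ G` is
nonpositive. -/
theorem re_inner_pencil_nonpos (hA : (A : E →ₗ[ℂ] E).IsSymmetric)
    (hG : (G : E →ₗ[ℂ] E).IsSymmetric) (hG0 : ∀ x, 0 ≤ (inner ℂ x (G x)).re) {μ : ℝ} {z : E}
    (hz : z ∈ ⨆ ν : Set.Iic μ, (A - ((ν : ℝ) : ℂ) • G).ker) :
    (inner ℂ z ((A - (μ : ℂ) • G) z)).re ≤ 0 := by
  obtain ⟨f, hf, rfl⟩ := (Submodule.mem_iSup_iff_exists_finsupp _ _).mp hz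
  have hG' : ∀ x y, inner ℂ (G x) y = inner ℂ x (G y) := hG
  have hA' : ∀ x y, inner ℂ (A x) y = inner ℂ x (A y) := hA
  have hker : ∀ ν, A (f ν) = ((ν : ℝ) : ℂ) • G (f ν) := fun ν => by
    simpa [sub_eq_zero] using hf ν
  -- Solutions for different parameters are `G`-orthogonal, so the form becomes a sum of terms `(ν -
  -- μ)⟨f ν, G (f ν)⟩`.
  have horth : ∀ ν ν', ν ≠ ν' → inner ℂ (f ν) (G (f ν')) = 0 := by
    intro ν ν' hne
    have h := hA' (f ν) (f ν')
    rw [hker, hker, inner_smul_left, inner_smul_right, Complex.conj_ofReal, hG', ← sub_eq_zero,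
      ← sub_mul] at h
    refine (mul_eq_zero.mp h).resolve_left fun h0 => hne ?_
    exact Subtype.ext (by exact_mod_cast sub_eq_zero.mp h0)
  have hsum : inner ℂ (f.sum fun _ a => a) ((A - (μ : ℂ) • G) (f.sum fun _ a => a)) =
      ∑ ν ∈ f.support, (((ν : ℝ) - μ : ℝ) : ℂ) * inner ℂ (f ν) (G (f ν)) := by
    rw [Finsupp.sum, sum_inner]
    refine Finset.sum_congr rfl fun ν hν => ?_
    rw [map_sum, inner_sum, Finset.sum_eq_single_of_mem ν hν]
    · simp [-Complex.coe_smul, hker, inner_smul_right, inner_sub_right, sub_mul]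
    · intro ν' _ hne
      simp [-Complex.coe_smul, hker, inner_smul_right, inner_sub_right, horth ν ν' hne.symm]
  rw [hsum, Complex.re_sum]
  refine Finset.sum_nonpos fun ν _ => ?_
  rw [Complex.re_ofReal_mul]
  exact mul_nonpos_of_nonpos_of_nonneg (sub_nonpos.mpr ν.2) (hG0 _)

end Pencil

end FeshbachSchur

/-! ### Diagonal and matrix operators on ℓ² -/

noncomputable section

namespace FeshbachSchur

open scoped ENNReal Topology

variable {ι : Type*}

theorem memℓp_two_iff {f : ι → ℂ} : Memℓp f 2 ↔ Summable fun i => ‖f i‖ ^ 2 := by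
  rw [memℓp_gen_iff (by norm_num)]
  simp

theorem sum_norm_sq_le (x : lp (fun _ : ι => ℂ) 2) (s : Finset ι) :
    ∑ i ∈ s, ‖x i‖ ^ 2 ≤ ‖x‖ ^ 2 := by
  simpa using lp.sum_rpow_le_norm_rpow (p := 2) (by norm_num) x s

theorem norm_sq_eq_tsum (x : lp (fun _ : ι => ℂ) 2) : ‖x‖ ^ 2 = ∑' i, ‖x i‖ ^ 2 := by
  simpa using lp.norm_rpow_eq_tsum (p := 2) (by norm_num) x

theorem norm_le_of_forall_sum_sq_le {x : lp (fun _ : ι => ℂ) 2} {C : ℝ} (hC : 0 ≤ C)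
    (h : ∀ s : Finset ι, ∑ i ∈ s, ‖x i‖ ^ 2 ≤ C ^ 2) : ‖x‖ ≤ C :=
  lp.norm_le_of_forall_sum_le (p := 2) (by norm_num) hC fun s => by simpa using h s

section Diagonal

/-- Multiplication of the coefficients by a real weight of absolute value at most `1`. -/
def lpDiag (w : ι → ℝ) (hw : ∀ n, ‖w n‖ ≤ 1) :
    lp (fun _ : ι => ℂ) 2 →L[ℂ] lp (fun _ : ι => ℂ) 2 :=
  have hle : ∀ (x : lp (fun _ : ι => ℂ) 2) n, ‖(w n : ℂ) * x n‖ ≤ ‖x n‖ := fun x n => by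
    rw [norm_mul, Complex.norm_real]
    exact mul_le_of_le_one_left (norm_nonneg _) (hw n)
  LinearMap.mkContinuous
    { toFun := fun x => ⟨fun n => (w n : ℂ) * x n, memℓp_two_iff.mpr <|
        (memℓp_two_iff.mp (lp.memℓp x)).of_nonneg_of_le (fun _ => by positivity) fun n => by
          gcongr; exact hle x n⟩
      map_add' := fun x y => lp.ext <| funext fun n => mul_add _ _ _
      map_smul' := fun c x => lp.ext <| funext fun n => mul_left_comm _ _ _ }
    1 fun x => by
      rw [one_mul]
      exact lp.norm_mono (by norm_num) (hle x)

@[simp]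
theorem lpDiag_apply (w : ι → ℝ) (hw : ∀ n, ‖w n‖ ≤ 1) (x : lp (fun _ : ι => ℂ) 2) (n : ι) :
    lpDiag w hw x n = (w n : ℂ) * x n := rfl

theorem inner_lpDiag_left (w : ι → ℝ) (hw : ∀ n, ‖w n‖ ≤ 1) (x y : lp (fun _ : ι => ℂ) 2) :
    inner ℂ (lpDiag w hw x) y = inner ℂ x (lpDiag w hw y) := by
  rw [lp.inner_eq_tsum, lp.inner_eq_tsum]
  refine tsum_congr fun n => ?_
  simp
  ring

theorem isSymmetric_lpDiag (w : ι → ℝ) (hw : ∀ n, ‖w n‖ ≤ 1) :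
    (lpDiag w hw : lp (fun _ : ι => ℂ) 2 →ₗ[ℂ] lp (fun _ : ι => ℂ) 2).IsSymmetric :=
  inner_lpDiag_left w hw

theorem re_inner_lpDiag (w : ι → ℝ) (hw : ∀ n, ‖w n‖ ≤ 1) (x : lp (fun _ : ι => ℂ) 2) :
    (inner ℂ x (lpDiag w hw x)).re = ∑' n, w n * ‖x n‖ ^ 2 := by
  rw [lp.inner_eq_tsum, Complex.re_tsum (lp.summable_inner _ _)]
  refine tsum_congr fun n => ?_
  rw [lpDiag_apply, RCLike.inner_apply, mul_assoc, Complex.re_ofReal_mul, RCLike.mul_conj]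
  norm_cast

theorem summable_mul_norm_sq (w : ι → ℝ) (hw : ∀ n, ‖w n‖ ≤ 1) (x : lp (fun _ : ι => ℂ) 2) :
    Summable fun n => w n * ‖x n‖ ^ 2 := by
  refine (memℓp_two_iff.mp (lp.memℓp x)).of_norm_bounded fun n => ?_
  rw [norm_mul, norm_pow, norm_norm]
  exact mul_le_of_le_one_left (by positivity) (hw n)

end Diagonal

section MatrixOperator

/-- The matrix `B` is Hermitian and bounded by `N` on finitely supported vectors. -/
structure IsBoundedHermitian (B : ι → ι → ℂ) (N : ℝ) : Prop where
  nonneg : 0 ≤ N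
  symm : ∀ k l, B l k = (starRingEnd ℂ) (B k l)
  bound : ∀ (x : ι →₀ ℂ) (s : Finset ι),
    ∑ k ∈ s, ‖x.sum fun l a => B k l * a‖ ^ 2 ≤ N ^ 2 * x.sum fun _ a => ‖a‖ ^ 2

variable {B : ι → ι → ℂ} {N : ℝ}

theorem IsBoundedHermitian.summable_col (hB : IsBoundedHermitian B N) (l : ι) :
    Summable fun k => ‖B k l‖ ^ 2 := by
  refine summable_of_sum_le (c := N ^ 2) (fun _ => by positivity) fun s => ?_
  simpa using hB.bound (Finsupp.single l 1) s

theorem IsBoundedHermitian.summable_row (hB : IsBoundedHermitian B N) (k : ι) :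
    Summable fun l => ‖B k l‖ ^ 2 := by
  refine (hB.summable_col k).congr fun l => ?_
  rw [hB.symm k l, RCLike.norm_conj]

theorem IsBoundedHermitian.summable_mul (hB : IsBoundedHermitian B N)
    (x : lp (fun _ : ι => ℂ) 2) (k : ι) : Summable fun l => B k l * x l := by
  refine (((hB.summable_row k).add (memℓp_two_iff.mp (lp.memℓp x))).of_norm_bounded fun l => ?_)
  rw [norm_mul]
  nlinarith [sq_nonneg (‖B k l‖ - ‖x l‖), sq_nonneg ‖B k l‖, sq_nonneg ‖x l‖]

/-- Truncate `x` to finite sets, where `bound` applies, and pass to the limit in the finitely many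
rows of `s`. -/
theorem IsBoundedHermitian.sum_tsum_le (hB : IsBoundedHermitian B N)
    (x : lp (fun _ : ι => ℂ) 2) (s : Finset ι) :
    ∑ k ∈ s, ‖∑' l, B k l * x l‖ ^ 2 ≤ (N * ‖x‖) ^ 2 := by
  have hlim : Filter.Tendsto (fun t : Finset ι => ∑ k ∈ s, ‖∑ l ∈ t, B k l * x l‖ ^ 2)
      Filter.atTop (𝓝 (∑ k ∈ s, ‖∑' l, B k l * x l‖ ^ 2)) :=
    tendsto_finsetSum _ fun k _ => ((hB.summable_mul x k).hasSum.norm).pow 2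
  refine le_of_tendsto' hlim fun t => ?_
  classical
  set y : ι →₀ ℂ := Finsupp.onFinset t (fun l => if l ∈ t then x l else 0)
    (fun l hl => by by_contra hlt; simp [hlt] at hl) with hy
  have h := hB.bound y s
  have e1 : ∀ k, (y.sum fun l a => B k l * a) = ∑ l ∈ t, B k l * x l := fun k => by
    rw [hy, Finsupp.onFinset_sum _ (by simp)]
    exact Finset.sum_congr rfl fun l hl => by simp [hl]
  have e2 : (y.sum fun _ a => ‖a‖ ^ 2) = ∑ l ∈ t, ‖x l‖ ^ 2 := by
    rw [hy, Finsupp.onFinset_sum _ (by simp)]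
    exact Finset.sum_congr rfl fun l hl => by simp [hl]
  simp only [e1, e2] at h
  rw [mul_pow]
  exact h.trans (mul_le_mul_of_nonneg_left (sum_norm_sq_le x t) (sq_nonneg N))

/-- The bounded operator on `ℓ²` with a given matrix. -/
def lpMatrix (hB : IsBoundedHermitian B N) :
    lp (fun _ : ι => ℂ) 2 →L[ℂ] lp (fun _ : ι => ℂ) 2 :=
  LinearMap.mkContinuous
    { toFun := fun x => ⟨fun k => ∑' l, B k l * x l, memℓp_two_iff.mpr <|
        summable_of_sum_le (fun _ => by positivity) (hB.sum_tsum_le x)⟩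
      map_add' := fun x y => lp.ext <| funext fun k => by
        change ∑' l, B k l * (x l + y l) = ∑' l, B k l * x l + ∑' l, B k l * y l
        rw [← (hB.summable_mul x k).tsum_add (hB.summable_mul y k)]
        simp_rw [mul_add]
      map_smul' := fun c x => lp.ext <| funext fun k => by
        change ∑' l, B k l * (c * x l) = c * ∑' l, B k l * x l
        rw [← tsum_mul_left]
        simp_rw [mul_left_comm] }
    N fun x => norm_le_of_forall_sum_sq_le (mul_nonneg hB.nonneg (norm_nonneg x))
      (hB.sum_tsum_le x)

theorem lpMatrix_apply (hB : IsBoundedHermitian B N) (x : lp (fun _ : ι => ℂ) 2) (k : ι) :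
    lpMatrix hB x k = ∑' l, B k l * x l := rfl

theorem norm_lpMatrix_apply_le (hB : IsBoundedHermitian B N) (x : lp (fun _ : ι => ℂ) 2) :
    ‖lpMatrix hB x‖ ≤ N * ‖x‖ :=
  norm_le_of_forall_sum_sq_le (mul_nonneg hB.nonneg (norm_nonneg x)) (hB.sum_tsum_le x)

theorem lpMatrix_single [DecidableEq ι] (hB : IsBoundedHermitian B N) (l : ι) (a : ℂ) (k : ι) :
    lpMatrix hB (lp.single 2 l a) k = B k l * a := by
  rw [lpMatrix_apply, tsum_eq_single l]
  · simp
  · intro m hm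
    simp [Pi.single_eq_of_ne hm]

/-- On coordinate vectors this is the Hermitian symmetry of `B`; continuity extends it to `x`, the
sum of its coordinates. -/
theorem isSymmetric_lpMatrix (hB : IsBoundedHermitian B N) :
    (lpMatrix hB : lp (fun _ : ι => ℂ) 2 →ₗ[ℂ] lp (fun _ : ι => ℂ) 2).IsSymmetric := by
  classical
  have h1 : ∀ l (a : ℂ) (y : lp (fun _ : ι => ℂ) 2),
      inner ℂ (lpMatrix hB (lp.single 2 l a)) y = inner ℂ (lp.single 2 l a) (lpMatrix hB y) := by
    intro l a y
    rw [lp.inner_single_left, lpMatrix_apply, lp.inner_eq_tsum, RCLike.inner_apply,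
      ← tsum_mul_right]
    refine tsum_congr fun k => ?_
    rw [lpMatrix_single, RCLike.inner_apply, map_mul, ← hB.symm]
    ring
  intro x y
  have hx := lp.hasSum_single (p := 2) (by norm_num) x
  have e1 := (hx.mapL (lpMatrix hB)).mapL (innerSLFlip ℂ y)
  have e2 := hx.mapL (innerSLFlip ℂ (lpMatrix hB y))
  simp only [innerSLFlip_apply_apply, h1] at e1 e2
  exact e1.unique e2

/-- A Hermitian matrix of finite `matrixOpNorm` is bounded by it. -/
theorem isBoundedHermitian_of_matrixOpNorm_ne_top (hB : matrixOpNorm B ≠ ⊤)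
    (hsymm : ∀ k l, B l k = (starRingEnd ℂ) (B k l)) :
    IsBoundedHermitian B (matrixOpNorm B).toReal := by
  refine ⟨ENNReal.toReal_nonneg, hsymm, fun x s => ?_⟩
  set N := (matrixOpNorm B).toReal with hN
  have key : ∀ y : ι →₀ ℂ, y.sum (fun _ a => ‖a‖ ^ 2) ≤ 1 →
      ∑ k ∈ s, ‖y.sum fun l a => B k l * a‖ ^ 2 ≤ N ^ 2 := by
    intro y hy
    have h1 : (∑' k, ‖y.sum (fun l a => B k l * a)‖ₑ ^ 2) ^ (1 / 2 : ℝ) ≤ matrixOpNorm B :=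
      le_iSup₂ (f := fun (x : ι →₀ ℂ) (_ : x.sum (fun _ a => ‖a‖ ^ 2) ≤ 1) =>
        (∑' k, ‖x.sum (fun l a => B k l * a)‖ₑ ^ 2) ^ (1 / 2 : ℝ)) y hy
    have h2 : ∑' k, ‖y.sum (fun l a => B k l * a)‖ₑ ^ 2 ≤ matrixOpNorm B ^ 2 := by
      have := ENNReal.rpow_le_rpow h1 (z := 2) (by norm_num)
      rwa [← ENNReal.rpow_mul, one_div, inv_mul_cancel₀ two_ne_zero, ENNReal.rpow_one,
        ENNReal.rpow_ofNat] at this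
    have h3 := (ENNReal.sum_le_tsum s).trans h2
    have h4 := ENNReal.toReal_mono (ENNReal.pow_ne_top hB) h3
    rw [ENNReal.toReal_pow, ENNReal.toReal_sum (fun k _ => by simp)] at h4
    simpa using h4
  -- The norm controls only the unit ball, so a nonzero `x` is rescaled by `1/√S`.
  set S := x.sum (fun _ a => ‖a‖ ^ 2) with hS
  have hS0 : 0 ≤ S := Finset.sum_nonneg fun _ _ => by positivity
  rcases hS0.eq_or_lt with h0 | h0
  · have hx : x = 0 := by
      ext l
      by_contra hl
      have hl' : l ∈ x.support := Finsupp.mem_support_iff.mpr hl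
      have := (Finset.sum_eq_zero_iff_of_nonneg fun _ _ => by positivity).mp h0.symm l hl'
      exact hl (by simpa using this)
    simp [hx, hS]
  · have hsq : √S ^ 2 = S := Real.sq_sqrt hS0
    have hpos : 0 < √S := Real.sqrt_pos.mpr h0
    set c : ℂ := (((√S)⁻¹ : ℝ) : ℂ) with hc
    have hnc : ‖c‖ ^ 2 = S⁻¹ := by
      rw [hc, Complex.norm_real, norm_inv, Real.norm_of_nonneg hpos.le, inv_pow, hsq]
    have h := key (c • x) (by
      rw [Finsupp.sum_smul_index (by simp)]
      simp only [norm_mul, mul_pow, hnc]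
      rw [← Finsupp.mul_sum, ← hS, inv_mul_cancel₀ h0.ne'])
    have e : ∀ k, ‖(c • x).sum fun l a => B k l * a‖ ^ 2 =
        S⁻¹ * ‖x.sum fun l a => B k l * a‖ ^ 2 := by
      intro k
      rw [Finsupp.sum_smul_index (by simp), ← hnc, ← mul_pow, ← norm_mul, Finsupp.mul_sum]
      simp_rw [mul_left_comm]
    simp only [e, ← Finset.mul_sum] at h
    rwa [inv_mul_le_iff₀ h0, mul_comm S] at h

end MatrixOperator

end FeshbachSchur

end

/-! ### The conjugated pencil and its coercivity on the high modes -/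

noncomputable section

namespace FeshbachSchur

section Weights

variable {d : ℕ} (L : ℝ)

theorem kSq_nonneg (n : Freq d) : 0 ≤ kSq L n :=
  mul_nonneg (sq_nonneg _) (Finset.sum_nonneg fun _ _ => sq_nonneg _)

/-- The weight `(1 + |k_n|²)^(1/2)` of `H¹_per`. -/
def weight (n : Freq d) : ℝ := √(1 + kSq L n)

theorem weight_sq (n : Freq d) : weight L n ^ 2 = 1 + kSq L n :=
  Real.sq_sqrt (by linarith [kSq_nonneg L n])

theorem weight_pos (n : Freq d) : 0 < weight L n :=
  Real.sqrt_pos.mpr (by linarith [kSq_nonneg L n])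

theorem ofReal_weight_ne_zero (n : Freq d) : (weight L n : ℂ) ≠ 0 :=
  Complex.ofReal_ne_zero.mpr (weight_pos L n).ne'

theorem one_le_weight (n : Freq d) : 1 ≤ weight L n :=
  Real.one_le_sqrt.mpr (by linarith [kSq_nonneg L n])

theorem norm_inv_weight_le (n : Freq d) : ‖(weight L n)⁻¹‖ ≤ 1 := by
  rw [Real.norm_of_nonneg (inv_nonneg.mpr (weight_pos L n).le)]
  exact inv_le_one_of_one_le₀ (one_le_weight L n)

theorem norm_inv_one_add_kSq_le (n : Freq d) : ‖(1 + kSq L n)⁻¹‖ ≤ 1 := by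
  have := kSq_nonneg L n
  rw [Real.norm_of_nonneg (by positivity)]
  exact inv_le_one_of_one_le₀ (by linarith)

theorem norm_rpow_weight_le {r : ℝ} (hr : 0 < r) (n : Freq d) :
    ‖(1 + kSq L n) ^ (-r / 2)‖ ≤ 1 := by
  have := kSq_nonneg L n
  rw [Real.norm_of_nonneg (by positivity)]
  exact Real.rpow_le_one_of_one_le_of_nonpos (by linarith) (by linarith)

/-- Multiplication by `weight` identifies H¹ with ℓ², and division by it identifies H⁻¹ with ℓ². -/
theorem memHs_one_iff {w : Freq d → ℂ} :
    MemHs L 1 w ↔ Memℓp (fun n => (weight L n : ℂ) * w n) 2 := by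
  rw [memℓp_two_iff, MemHs]
  refine summable_congr fun n => ?_
  rw [norm_mul, mul_pow, Complex.norm_real, Real.norm_of_nonneg (weight_pos L n).le, weight_sq,
    Real.rpow_one]

theorem memHs_neg_one_iff {f : Freq d → ℂ} :
    MemHs L (-1) f ↔ Memℓp (fun n => (weight L n : ℂ)⁻¹ * f n) 2 := by
  rw [memℓp_two_iff, MemHs]
  refine summable_congr fun n => ?_
  rw [norm_mul, mul_pow, norm_inv, Complex.norm_real, Real.norm_of_nonneg (weight_pos L n).le,
    inv_pow, weight_sq, Real.rpow_neg_one]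

end Weights

section Operators

variable {d : ℕ} (L : ℝ)

/-- `(-Δ + 1)^(-1/2)` -/
def invSqrtOp : L2per d →L[ℂ] L2per d :=
  lpDiag (fun n => (weight L n)⁻¹) (norm_inv_weight_le L)

/-- `(-Δ + 1)⁻¹` -/
def invOp : L2per d →L[ℂ] L2per d :=
  lpDiag (fun n => (1 + kSq L n)⁻¹) (norm_inv_one_add_kSq_le L)

/-- `(-Δ + 1)^(-r/2)` -/
def rpowOp {r : ℝ} (hr : 0 < r) : L2per d →L[ℂ] L2per d :=
  lpDiag (fun n => (1 + kSq L n) ^ (-r / 2)) (norm_rpow_weight_le L hr)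

open Classical in
/-- The projection `P_M^⊥`. -/
def highProj (M : ℕ) : L2per d →L[ℂ] L2per d :=
  lpDiag (fun n => if IsLow L M n then 0 else 1) fun n => by split_ifs <;> simp

/-- The matrix of `(-Δ + 1)^(-1/2 + r/2) V (-Δ + 1)^(-1/2 + r/2)`. -/
def potMatrix (r : ℝ) (V : Freq d → ℂ) (k l : Freq d) : ℂ :=
  (((1 + kSq L k) ^ (-1 / 2 + r / 2) : ℝ) : ℂ) * V (k - l) *
    (((1 + kSq L l) ^ (-1 / 2 + r / 2) : ℝ) : ℂ)

theorem isBoundedHermitian_potMatrix {r : ℝ} {V : Freq d → ℂ} (hV : IsRealPot V)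
    (hVr : potNorm L r V ≠ ⊤) :
    IsBoundedHermitian (potMatrix L r V) (potNorm L r V).toReal := by
  refine isBoundedHermitian_of_matrixOpNorm_ne_top hVr fun k l => ?_
  rw [potMatrix, potMatrix, map_mul, map_mul, Complex.conj_ofReal, Complex.conj_ofReal, ← hV,
    neg_sub]
  ring

variable {L} {r N : ℝ} {V : Freq d → ℂ} {M : ℕ}

/-- `(-Δ + 1)^(-1/2) V (-Δ + 1)^(-1/2)` -/
def potOp (hr : 0 < r) (hB : IsBoundedHermitian (potMatrix L r V) N) : L2per d →L[ℂ] L2per d :=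
  -- The outer factors of order `-r/2` stay apart from the bounded matrix: on high modes they supply
  -- the smallness.
  (rpowOp L hr).comp ((lpMatrix hB).comp (rpowOp L hr))

/-- `(-Δ + 1)^(-1/2) (-Δ + V) (-Δ + 1)^(-1/2)` -/
def energyOp (hr : 0 < r) (hB : IsBoundedHermitian (potMatrix L r V) N) :
    L2per d →L[ℂ] L2per d :=
  1 - invOp L + potOp hr hB

/-- `(-Δ + 1)^(-1/2) (-Δ + V - t) (-Δ + 1)^(-1/2)` -/
abbrev pencil (hr : 0 < r) (hB : IsBoundedHermitian (potMatrix L r V) N) (t : ℝ) :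
    L2per d →L[ℂ] L2per d :=
  energyOp hr hB - (t : ℂ) • invOp L

theorem highProj_apply_low (z : L2per d) {n : Freq d} (hn : IsLow L M n) :
    highProj L M z n = 0 := by
  simp [highProj, hn]

theorem highProj_apply_high (z : L2per d) {n : Freq d} (hn : ¬ IsLow L M n) :
    highProj L M z n = z n := by
  simp [highProj, hn]

theorem isSymmetric_highProj : ((highProj L M : L2per d →L[ℂ] L2per d) : L2per d →ₗ[ℂ] L2per d).IsSymmetric :=
  isSymmetric_lpDiag _ _

theorem highProj_highProj (z : L2per d) : highProj L M (highProj L M z) = highProj L M z := by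
  refine lp.ext (funext fun n => ?_)
  by_cases hn : IsLow L M n
  · rw [highProj_apply_low _ hn, highProj_apply_low _ hn]
  · rw [highProj_apply_high _ hn]

theorem highProj_invOp (z : L2per d) :
    highProj L M (invOp L z) = invOp L (highProj L M z) := by
  refine lp.ext (funext fun n => ?_)
  simp only [highProj, invOp, lpDiag_apply]
  ring

theorem highProj_eq_self_iff {z : L2per d} :
    highProj L M z = z ↔ ∀ n, IsLow L M n → z n = 0 := by
  refine ⟨fun h n hn => by rw [← h, highProj_apply_low _ hn],
    fun h => lp.ext (funext fun n => ?_)⟩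
  by_cases hn : IsLow L M n
  · rw [highProj_apply_low _ hn, h n hn]
  · rw [highProj_apply_high _ hn]

theorem isSymmetric_invOp : ((invOp L : L2per d →L[ℂ] L2per d) : L2per d →ₗ[ℂ] L2per d).IsSymmetric :=
  isSymmetric_lpDiag _ _

theorem re_inner_invOp_nonneg (z : L2per d) : 0 ≤ (inner ℂ z (invOp L z)).re := by
  rw [invOp, re_inner_lpDiag]
  exact tsum_nonneg fun n => mul_nonneg
    (inv_nonneg.mpr (by linarith [kSq_nonneg L n])) (sq_nonneg _)

theorem isSymmetric_energyOp (hr : 0 < r) (hB : IsBoundedHermitian (potMatrix L r V) N) :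
    (energyOp hr hB : L2per d →ₗ[ℂ] L2per d).IsSymmetric := by
  intro x y
  have hG : ∀ x y : L2per d, inner ℂ (invOp L x) y = inner ℂ x (invOp L y) := isSymmetric_invOp
  have hD : ∀ x y : L2per d, inner ℂ (rpowOp L hr x) y = inner ℂ x (rpowOp L hr y) :=
    isSymmetric_lpDiag _ _
  have hT : ∀ x y, inner ℂ (lpMatrix hB x) y = inner ℂ x (lpMatrix hB y) :=
    isSymmetric_lpMatrix hB
  simp [energyOp, potOp, inner_add_left, inner_add_right, inner_sub_left, inner_sub_right, hG, hD,
    hT]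

theorem rpow_mul_rpow_eq_inv_weight (n : Freq d) :
    (1 + kSq L n) ^ (-r / 2) * (1 + kSq L n) ^ (-1 / 2 + r / 2) = (weight L n)⁻¹ := by
  have h : 0 < 1 + kSq L n := by linarith [kSq_nonneg L n]
  rw [← Real.rpow_add h, weight, Real.sqrt_eq_rpow, ← Real.rpow_neg h.le]
  congr 1
  ring

theorem potOp_apply (hr : 0 < r) (hB : IsBoundedHermitian (potMatrix L r V) N) (z : L2per d)
    (n : Freq d) :
    (weight L n : ℂ) * potOp hr hB z n = mulPot V (fun m => (weight L m : ℂ)⁻¹ * z m) n := by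
  change (weight L n : ℂ) * ((((1 + kSq L n) ^ (-r / 2) : ℝ) : ℂ) * ∑' l, potMatrix L r V n l *
    ((((1 + kSq L l) ^ (-r / 2) : ℝ) : ℂ) * z l)) = _
  rw [mulPot, ← tsum_mul_left, ← tsum_mul_left]
  refine tsum_congr fun l => ?_
  have e : ∀ m : Freq d, (((1 + kSq L m) ^ (-r / 2) : ℝ) : ℂ) *
      (((1 + kSq L m) ^ (-1 / 2 + r / 2) : ℝ) : ℂ) = (weight L m : ℂ)⁻¹ := fun m => by
    rw [← Complex.ofReal_mul, rpow_mul_rpow_eq_inv_weight, Complex.ofReal_inv]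
  rw [potMatrix, ← e l]
  have h := ofReal_weight_ne_zero L n
  have e' := e n
  rw [← one_div, eq_div_iff h] at e'
  linear_combination (V (n - l) * (((1 + kSq L l) ^ (-1 / 2 + r / 2) : ℝ) : ℂ) *
    (((1 + kSq L l) ^ (-r / 2) : ℝ) : ℂ) * z l) * e'

/-- The pencil is `-Δ + V - t`, seen from `H¹_per` to `H⁻¹_per`. -/
theorem pencil_apply (hr : 0 < r) (hB : IsBoundedHermitian (potMatrix L r V) N) (t : ℝ)
    (z : L2per d) (n : Freq d) :
    (weight L n : ℂ) * pencil hr hB t z n =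
      (kSq L n : ℂ) * ((weight L n : ℂ)⁻¹ * z n) +
        mulPot V (fun m => (weight L m : ℂ)⁻¹ * z m) n - (t : ℂ) * ((weight L n : ℂ)⁻¹ * z n) := by
  rw [← potOp_apply hr hB]
  have h1 : pencil hr hB t z n =
      z n - (((1 + kSq L n)⁻¹ : ℝ) : ℂ) * z n + potOp hr hB z n -
        (t : ℂ) * ((((1 + kSq L n)⁻¹ : ℝ) : ℂ) * z n) := rfl
  have h := ofReal_weight_ne_zero L n
  have e : (kSq L n : ℂ) = (weight L n : ℂ) ^ 2 - 1 := by
    rw [← Complex.ofReal_pow, weight_sq]; push_cast; ring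
  rw [h1, ← weight_sq, e]
  push_cast
  field_simp

theorem tsum_mul_norm_sq_le_of_high {w : Freq d → ℝ} (hw : ∀ n, ‖w n‖ ≤ 1) {c : ℝ}
    (hc : ∀ n, ¬ IsLow L M n → w n ≤ c) {z : L2per d} (hz : highProj L M z = z) :
    ∑' n, w n * ‖z n‖ ^ 2 ≤ c * ‖z‖ ^ 2 := by
  rw [norm_sq_eq_tsum, ← tsum_mul_left]
  refine (summable_mul_norm_sq w hw z).tsum_le_tsum (fun n => ?_)
    ((memℓp_two_iff.mp (lp.memℓp z)).mul_left c)
  by_cases hn : IsLow L M n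
  · simp [highProj_eq_self_iff.mp hz n hn]
  · exact mul_le_mul_of_nonneg_right (hc n hn) (sq_nonneg _)

theorem re_inner_invOp_le_of_high {z : L2per d} (hz : highProj L M z = z) :
    (inner ℂ z (invOp L z)).re ≤ (1 + rho L M)⁻¹ * ‖z‖ ^ 2 := by
  rw [invOp, re_inner_lpDiag]
  refine tsum_mul_norm_sq_le_of_high (norm_inv_one_add_kSq_le L) (fun n hn => ?_) hz
  have h1 : rho L M ≤ kSq L n := not_lt.mp hn
  have h2 : 0 ≤ rho L M := sq_nonneg _
  gcongr

theorem norm_sq_rpowOp_le_of_high (hr : 0 < r) {z : L2per d} (hz : highProj L M z = z) :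
    ‖rpowOp L hr z‖ ^ 2 ≤ (1 + rho L M) ^ (-r) * ‖z‖ ^ 2 := by
  have e : ∀ n, ‖rpowOp L hr z n‖ ^ 2 = (1 + kSq L n) ^ (-r) * ‖z n‖ ^ 2 := by
    intro n
    have h0 := kSq_nonneg L n
    rw [rpowOp, lpDiag_apply, norm_mul, mul_pow, Complex.norm_real,
      Real.norm_of_nonneg (by positivity), ← Real.rpow_natCast, ← Real.rpow_mul (by positivity)]
    congr 2
    push_cast
    ring
  rw [norm_sq_eq_tsum]
  simp_rw [e]
  refine tsum_mul_norm_sq_le_of_high (fun n => ?_) (fun n hn => ?_) hz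
  · have := kSq_nonneg L n
    rw [Real.norm_of_nonneg (by positivity)]
    exact Real.rpow_le_one_of_one_le_of_nonpos (by linarith) (by linarith)
  · have h1 : rho L M ≤ kSq L n := not_lt.mp hn
    have h2 : 0 ≤ rho L M := sq_nonneg _
    exact Real.rpow_le_rpow_of_nonpos (by linarith) (by linarith) (by linarith)

/-- Each of the two outer factors contributes `(1 + ρ)^(-r/2)` on high modes. -/
theorem neg_le_re_inner_potOp_of_high (hr : 0 < r)
    (hB : IsBoundedHermitian (potMatrix L r V) N) {z : L2per d} (hz : highProj L M z = z) :
    -(N * (1 + rho L M) ^ (-r) * ‖z‖ ^ 2) ≤ (inner ℂ z (potOp hr hB z)).re := by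
  have hD : ∀ x y : L2per d, inner ℂ (rpowOp L hr x) y = inner ℂ x (rpowOp L hr y) :=
    isSymmetric_lpDiag _ _
  have h1 : inner ℂ z (potOp hr hB z) =
      inner ℂ (rpowOp L hr z) (lpMatrix hB (rpowOp L hr z)) := by
    rw [hD]; rfl
  rw [h1]
  have h2 := (abs_le.mp ((Complex.abs_re_le_norm _).trans
    (norm_inner_le_norm (𝕜 := ℂ) (rpowOp L hr z) (lpMatrix hB (rpowOp L hr z))))).1
  have h3 := mul_le_mul_of_nonneg_left (norm_lpMatrix_apply_le hB (rpowOp L hr z))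
    (norm_nonneg (rpowOp L hr z))
  have h4 := mul_le_mul_of_nonneg_left (norm_sq_rpowOp_le_of_high hr hz) hB.nonneg
  nlinarith

/-- Below `κ_M` the pencil is coercive on the high modes, uniformly in half-lines. -/
theorem exists_coercive (hr : 0 < r) (hB : IsBoundedHermitian (potMatrix L r V) N)
    (hρ : 0 < rho L M) (hN : rho L M ^ (-r) * N ≤ 1) {b : ℝ}
    (hb : b < rho L M - (rho L M + 1) * rho L M ^ (-r) * N) :
    ∃ δ > 0, ∀ t ≤ b, ∀ z : L2per d, highProj L M z = z →
      δ * ‖z‖ ^ 2 ≤ (inner ℂ z (pencil hr hB t z)).re := by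
  -- `hN` allows equality; this strict inequality is what gives `c < 1` below.
  have hlt : (1 + rho L M) ^ (-r) < rho L M ^ (-r) :=
    Real.rpow_lt_rpow_of_neg hρ (by linarith) (by linarith)
  have hNle : N * (1 + rho L M) ^ (-r) ≤ rho L M ^ (-r) * N := by
    nlinarith [mul_le_mul_of_nonneg_left hlt.le hB.nonneg]
  have hlt1 : N * (1 + rho L M) ^ (-r) < 1 := by
    rcases hB.nonneg.eq_or_lt with h | h
    · rw [← h]; norm_num
    · nlinarith [mul_lt_mul_of_pos_left hlt h]
  set c := N * (1 + rho L M) ^ (-r) with hc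
  have hinv : (1 + rho L M) * (1 + rho L M)⁻¹ = 1 := mul_inv_cancel₀ (by linarith)
  have hinvpos : 0 < (1 + rho L M)⁻¹ := inv_pos.mpr (by linarith)
  -- The form is at least `(1 - c)‖z‖² - (1 + t)⟨z, G z⟩` with `G ≤ (1 + ρ)⁻¹` on high modes; `max`
  -- covers negative `1 + b`. Positivity comes from `b < κ_M` and `c ≤ ρ^(-r) N` in one case, from
  -- `c < 1` in the other.
  refine ⟨1 - c - max (1 + b) 0 * (1 + rho L M)⁻¹, ?_, fun t ht z hz => ?_⟩
  · rcases max_cases (1 + b) 0 with ⟨h, -⟩ | ⟨h, -⟩ <;> rw [h]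
    · have h1 : 1 + b < (1 - c) * (1 + rho L M) := by nlinarith
      have h2 := mul_lt_mul_of_pos_right h1 hinvpos
      rw [mul_assoc, hinv] at h2
      linarith
    · linarith
  · have e : (inner ℂ z (pencil hr hB t z)).re =
        ‖z‖ ^ 2 - (1 + t) * (inner ℂ z (invOp L z)).re + (inner ℂ z (potOp hr hB z)).re := by
      rw [re_inner_sub_smul, energyOp, add_apply, sub_apply, one_apply_eq_self,
        inner_add_right, inner_sub_right, Complex.add_re, Complex.sub_re]
      have hn : (inner ℂ z z).re = ‖z‖ ^ 2 := inner_self_eq_norm_sq (𝕜 := ℂ) z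
      rw [hn]
      ring
    rw [e]
    have h1 := neg_le_re_inner_potOp_of_high hr hB hz
    have h2 := re_inner_invOp_le_of_high hz
    have h3 := re_inner_invOp_nonneg (L := L) z
    have h4 : (1 + t) * (inner ℂ z (invOp L z)).re ≤
        max (1 + b) 0 * ((1 + rho L M)⁻¹ * ‖z‖ ^ 2) :=
      (mul_le_mul_of_nonneg_right (le_trans (by linarith) (le_max_left (1 + b) 0)) h3).trans
        (mul_le_mul_of_nonneg_left h2 (le_max_right _ _))
    rw [← hc] at h1
    linarith

end Operators

end FeshbachSchur

end

/-! ### The weak resolvent and the effective Hamiltonian as a Schur complement -/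

noncomputable section

namespace FeshbachSchur

section Resolvent

variable {d : ℕ} {L r N : ℝ} {V : Freq d → ℂ} {M : ℕ} {hr : 0 < r}
  {hB : IsBoundedHermitian (potMatrix L r V) N} {t : ℝ} {R : L2per d →L[ℂ] L2per d} {δ : ℝ}

/-- Weak solutions on the high modes are given by the inverse of the compressed pencil. -/
theorem isPerpSolution_iff (hR : IsCompressedInverse (highProj L M) (pencil hr hB t) R)
    (hδ : 0 < δ) (hc : ∀ z : L2per d, highProj L M z = z →
      δ * ‖z‖ ^ 2 ≤ (inner ℂ z (pencil hr hB t z)).re)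
    {f w : Freq d → ℂ} {g : L2per d} (hg : ∀ n, g n = (weight L n : ℂ)⁻¹ * f n) :
    IsPerpSolution L V M t f w ↔ w = fun n => (weight L n : ℂ)⁻¹ * R g n := by
  have hrhs : ∀ z : L2per d, highProj L M (pencil hr hB t z) = highProj L M g ↔
      ∀ n, ¬ IsLow L M n → (kSq L n : ℂ) * ((weight L n : ℂ)⁻¹ * z n) +
        mulPot V (fun m => (weight L m : ℂ)⁻¹ * z m) n -
          (t : ℂ) * ((weight L n : ℂ)⁻¹ * z n) = f n := by
    intro z
    have h1 : ∀ n, (pencil hr hB t z) n = g n ↔ (kSq L n : ℂ) * ((weight L n : ℂ)⁻¹ * z n) +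
        mulPot V (fun m => (weight L m : ℂ)⁻¹ * z m) n -
          (t : ℂ) * ((weight L n : ℂ)⁻¹ * z n) = f n := by
      intro n
      rw [← pencil_apply hr hB, hg, eq_inv_mul_iff_mul_eq₀ (ofReal_weight_ne_zero L n)]
    refine ⟨fun h n hn => (h1 n).mp ?_, fun h => lp.ext (funext fun n => ?_)⟩
    · rw [← highProj_apply_high _ hn, h, highProj_apply_high _ hn]
    · by_cases hn : IsLow L M n
      · rw [highProj_apply_low _ hn, highProj_apply_low _ hn]
      · rw [highProj_apply_high _ hn, highProj_apply_high _ hn, (h1 n).mpr (h n hn)]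
  constructor
  · rintro ⟨hw, hlow, heq⟩
    set z : L2per d := ⟨_, memHs_one_iff L |>.mp hw⟩ with hz
    have hzw : (fun n => (weight L n : ℂ)⁻¹ * z n) = w :=
      funext fun n => inv_mul_cancel_left₀ (ofReal_weight_ne_zero L n) (w n)
    have hQz : highProj L M z = z := highProj_eq_self_iff.mpr fun n hn => by
      change (weight L n : ℂ) * w n = 0
      rw [hlow n hn, mul_zero]
    have hz' : highProj L M (pencil hr hB t z) = highProj L M g := by
      rw [hrhs, hzw]
      intro n hn
      rw [congrFun hzw n]
      exact heq n hn
    rw [← hR.eq_of_coercive isSymmetric_highProj hδ hc hQz hz', hzw]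
  · rintro rfl
    refine ⟨(memHs_one_iff L).mpr ?_, fun n hn => ?_, (hrhs (R g)).mp (hR.proj_apply_apply g)⟩
    · convert lp.memℓp (R g) using 2 with n
      rw [mul_inv_cancel_left₀ (ofReal_weight_ne_zero L n)]
    · exact mul_eq_zero_of_right _ (highProj_eq_self_iff.mp (hR.proj_apply g) n hn)

theorem perpInvertible_of_coercive
    (hR : IsCompressedInverse (highProj L M) (pencil hr hB t) R)
    (hδ : 0 < δ) (hc : ∀ z : L2per d, highProj L M z = z →
      δ * ‖z‖ ^ 2 ≤ (inner ℂ z (pencil hr hB t z)).re) :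
    PerpInvertible L V M t := by
  intro f hf
  simp_rw [isPerpSolution_iff hR hδ hc (g := ⟨_, (memHs_neg_one_iff L).mp hf⟩) fun _ => rfl]
  exact existsUnique_eq

/-- Existence excludes the default value `0`, and uniqueness identifies the chosen solution. -/
theorem perpResolvent_eq (hR : IsCompressedInverse (highProj L M) (pencil hr hB t) R)
    (hδ : 0 < δ) (hc : ∀ z : L2per d, highProj L M z = z →
      δ * ‖z‖ ^ 2 ≤ (inner ℂ z (pencil hr hB t z)).re)
    {f : Freq d → ℂ} {g : L2per d} (hg : ∀ n, g n = (weight L n : ℂ)⁻¹ * f n) :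
    perpResolvent L V M t f = fun n => (weight L n : ℂ)⁻¹ * R g n := by
  have h : ∃ w, IsPerpSolution L V M t f w := ⟨_, (isPerpSolution_iff hR hδ hc hg).mpr rfl⟩
  rw [perpResolvent, dif_pos h]
  exact (isPerpSolution_iff hR hδ hc hg).mp h.choose_spec

end Resolvent

section EffectiveHamiltonian

variable {d : ℕ} {L r N : ℝ} {V : Freq d → ℂ} {M : ℕ} {hr : 0 < r}
  {hB : IsBoundedHermitian (potMatrix L r V) N} {t : ℝ} {R : L2per d →L[ℂ] L2per d} {δ : ℝ}

variable (L) in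
/-- The image of the plane wave `e_l` under `(-Δ + 1)^(1/2)`. -/
def weightedWave (l : Freq d) : L2per d := lp.single 2 l (weight L l : ℂ)

theorem weightedWave_of_ne {l n : Freq d} (h : n ≠ l) : weightedWave L l n = 0 :=
  Pi.single_eq_of_ne h _

theorem weightedWave_self (l : Freq d) : weightedWave L l l = (weight L l : ℂ) :=
  Pi.single_eq_same _ _

theorem inner_weightedWave (l : Freq d) (z : L2per d) :
    inner ℂ (weightedWave L l) z = (weight L l : ℂ) * z l := by
  rw [weightedWave, lp.inner_single_left, RCLike.inner_apply, Complex.conj_ofReal, mul_comm]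

theorem inv_weight_mul_weightedWave (l n : Freq d) :
    (weight L n : ℂ)⁻¹ * weightedWave L l n = if n = l then 1 else 0 := by
  split_ifs with h
  · rw [h, weightedWave_self, inv_mul_cancel₀ (ofReal_weight_ne_zero L l)]
  · rw [weightedWave_of_ne h, mul_zero]

theorem pencil_weightedWave (l n : Freq d) :
    (weight L n : ℂ) * pencil hr hB t (weightedWave L l) n =
      (if n = l then (kSq L n : ℂ) else 0) + V (n - l) - (t : ℂ) * if n = l then 1 else 0 := by
  rw [pencil_apply, inv_weight_mul_weightedWave]
  simp_rw [inv_weight_mul_weightedWave]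
  have : mulPot V (fun m => if m = l then 1 else 0) n = V (n - l) := by
    rw [mulPot, tsum_eq_single l fun m hm => by simp [hm]]
    simp
  rw [this, mul_ite, mul_one, mul_zero]

/-- The lifted waves are orthonormal for the form of G, so `t G` acts as `t` times the identity on
`X_M`. -/
theorem inner_weightedWave_invOp (k l : Freq d) :
    inner ℂ (weightedWave L k) (invOp L (weightedWave L l)) = if k = l then 1 else 0 := by
  rw [inner_weightedWave, invOp, lpDiag_apply]
  split_ifs with h
  · have := ofReal_weight_ne_zero L l
    rw [h, weightedWave_self, ← weight_sq]
    push_cast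
    field_simp
  · rw [weightedWave_of_ne h, mul_zero, mul_zero]

/-- The Schur complement represents `H_M(t) - t` on the lifted waves; the `invOp` term restores the
shift. -/
theorem effHamiltonian_apply (hR : IsCompressedInverse (highProj L M) (pencil hr hB t) R)
    (hδ : 0 < δ) (hc : ∀ z : L2per d, highProj L M z = z →
      δ * ‖z‖ ^ 2 ≤ (inner ℂ z (pencil hr hB t z)).re) (k l : Low d L M) :
    effHamiltonian L V M t k l =
      inner ℂ (weightedWave L k.1) (schur (pencil hr hB t) R (weightedWave L l.1)) +
        (t : ℂ) * inner ℂ (weightedWave L k.1) (invOp L (weightedWave L l.1)) := by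
  set g : L2per d := potOp hr hB (weightedWave L l.1) with hgdef
  have hg : ∀ n, g n = (weight L n : ℂ)⁻¹ * V (n - l.1) := by
    intro n
    rw [eq_inv_mul_iff_mul_eq₀ (ofReal_weight_ne_zero L n), hgdef, potOp_apply]
    simp_rw [inv_weight_mul_weightedWave]
    rw [mulPot, tsum_eq_single l.1 fun m hm => by simp [hm]]
    simp
  -- At a high index `n ≠ l` the kinetic and shift terms vanish, so `R` sees only the potential `V
  -- e_l`.
  have hQg : highProj L M (pencil hr hB t (weightedWave L l.1)) = highProj L M g := by
    refine lp.ext (funext fun n => ?_)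
    by_cases hn : IsLow L M n
    · rw [highProj_apply_low _ hn, highProj_apply_low _ hn]
    · rw [highProj_apply_high _ hn, highProj_apply_high _ hn, hg,
        eq_inv_mul_iff_mul_eq₀ (ofReal_weight_ne_zero L n), pencil_weightedWave]
      have hne : n ≠ l.1 := fun h => hn (h ▸ l.2)
      simp [hne]
  have hRg : R (pencil hr hB t (weightedWave L l.1)) = R g :=
    hR.eq_of_coercive isSymmetric_highProj hδ hc (hR.proj_apply _)
      ((hR.proj_apply_apply _).trans hQg)
  -- Since `R g` has no low coefficient, only the potential couples it back to `k`.
  have hRk : R g k.1 = 0 := highProj_eq_self_iff.mp (hR.proj_apply g) _ k.2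
  have hschur : schur (pencil hr hB t) R (weightedWave L l.1) k.1 =
      pencil hr hB t (weightedWave L l.1) k.1 - pencil hr hB t (R g) k.1 := by
    rw [← hRg]; rfl
  rw [inner_weightedWave, hschur, mul_sub, pencil_weightedWave, pencil_apply, hRk,
    inner_weightedWave_invOp, effHamiltonian, Matrix.add_apply, galerkin, effInteraction,
    Matrix.of_apply, Matrix.of_apply, perpResolvent_eq hR hδ hc hg]
  simp only [Subtype.ext_iff]
  ring

theorem isHermitian_effHamiltonian
    (hR : IsCompressedInverse (highProj L M) (pencil hr hB t) R)
    (hδ : 0 < δ) (hc : ∀ z : L2per d, highProj L M z = z →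
      δ * ‖z‖ ^ 2 ≤ (inner ℂ z (pencil hr hB t z)).re) :
    (effHamiltonian L V M t).IsHermitian := by
  have hA := isSymmetric_sub_smul (isSymmetric_energyOp hr hB) (isSymmetric_invOp (L := L)) t
  have hS := isSymmetric_schur hA (hR.isSymmetric isSymmetric_highProj hA)
  ext k l
  have h1 := hS (weightedWave L k.1) (weightedWave L l.1)
  have h2 := (isSymmetric_invOp (L := L)) (weightedWave L k.1) (weightedWave L l.1)
  rw [Matrix.conjTranspose_apply, effHamiltonian_apply hR hδ hc, effHamiltonian_apply hR hδ hc,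
    star_add, star_mul', Complex.star_def, inner_conj_symm, inner_conj_symm, Complex.conj_ofReal]
  exact congrArg₂ (fun a b => a + (t : ℂ) * b) h1 h2

variable (d L M) in
/-- The isomorphism `(-Δ + 1)^(1/2)` of `X_M`, as a map from coordinates. -/
def lowLift : EuclideanSpace ℂ (Low d L M) →L[ℂ] L2per d :=
  ∑ l : Low d L M, (EuclideanSpace.proj l).smulRight (weightedWave L l.1)

theorem lowLift_apply (u : EuclideanSpace ℂ (Low d L M)) :
    lowLift d L M u = ∑ l, u l • weightedWave L l.1 := by
  simp [lowLift]

theorem inner_lowLift (T : L2per d →L[ℂ] L2per d) (u : EuclideanSpace ℂ (Low d L M)) :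
    inner ℂ (lowLift d L M u) (T (lowLift d L M u)) = ∑ k, ∑ l, (starRingEnd ℂ) (u k) * (u l *
      inner ℂ (weightedWave L k.1) (T (weightedWave L l.1))) := by
  rw [lowLift_apply, sum_inner]
  refine Finset.sum_congr rfl fun k _ => ?_
  rw [map_sum, inner_sum]
  refine Finset.sum_congr rfl fun l _ => ?_
  rw [map_smul, inner_smul_left, inner_smul_right]

theorem highProj_lowLift (u : EuclideanSpace ℂ (Low d L M)) :
    highProj L M (lowLift d L M u) = 0 := by
  rw [lowLift_apply, map_sum]
  refine Finset.sum_eq_zero fun l _ => ?_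
  rw [map_smul]
  convert smul_zero (u l)
  refine lp.ext (funext fun n => ?_)
  by_cases hn : IsLow L M n
  · rw [highProj_apply_low _ hn]; rfl
  · rw [highProj_apply_high _ hn, weightedWave_of_ne fun h : n = l.1 => hn (h ▸ l.2)]; rfl

theorem re_inner_lowLift_invOp (u : EuclideanSpace ℂ (Low d L M)) :
    (inner ℂ (lowLift d L M u) (invOp L (lowLift d L M u))).re = ‖u‖ ^ 2 := by
  have h : inner ℂ (lowLift d L M u) (invOp L (lowLift d L M u)) = inner ℂ u u := by
    rw [inner_lowLift, PiLp.inner_apply]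
    refine Finset.sum_congr rfl fun k _ => ?_
    simp_rw [inner_weightedWave_invOp, ← Subtype.ext_iff]
    simp [Complex.conj_mul']
  rw [h]
  exact inner_self_eq_norm_sq (𝕜 := ℂ) u

/-- The form of `H_M(t)` is the effective form of the pencil. -/
theorem inner_effHamiltonian [DecidableEq (Low d L M)]
    (hR : IsCompressedInverse (highProj L M) (pencil hr hB t) R)
    (hδ : 0 < δ) (hc : ∀ z : L2per d, highProj L M z = z →
      δ * ‖z‖ ^ 2 ≤ (inner ℂ z (pencil hr hB t z)).re) (u : EuclideanSpace ℂ (Low d L M)) :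
    (inner ℂ u ((effHamiltonian L V M t).toEuclideanLin u)).re =
      (inner ℂ (lowLift d L M u) (schur (pencil hr hB t) R (lowLift d L M u))).re +
        t * (inner ℂ (lowLift d L M u) (invOp L (lowLift d L M u))).re := by
  rw [← Complex.re_ofReal_mul, ← Complex.add_re, inner_lowLift, inner_lowLift, Finset.mul_sum,
    ← Finset.sum_add_distrib, PiLp.inner_apply]
  congr 1
  refine Finset.sum_congr rfl fun k _ => ?_
  rw [RCLike.inner_apply, Matrix.toLpLin_apply, Finset.mul_sum, ← Finset.sum_add_distrib,
    mul_comm]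
  change _ * (∑ l, effHamiltonian L V M t k l * u l) = _
  rw [Finset.mul_sum]
  refine Finset.sum_congr rfl fun l _ => ?_
  rw [effHamiltonian_apply hR hδ hc]
  ring

variable (d L M) in
/-- The coordinates in `X_M` of `(-Δ + 1)^(-1/2) z`. -/
def lowCoord : L2per d →ₗ[ℂ] EuclideanSpace ℂ (Low d L M) where
  toFun z := WithLp.toLp 2 fun l => (weight L l.1 : ℂ)⁻¹ * z l.1
  map_add' _ _ := PiLp.ext fun _ => mul_add _ _ _
  map_smul' _ _ := PiLp.ext fun _ => mul_left_comm _ _ _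

/-- A vector with vanishing `lowCoord` is therefore purely high, hence subject to coercivity. -/
theorem lowLift_lowCoord (z : L2per d) :
    lowLift d L M (lowCoord d L M z) = z - highProj L M z := by
  refine lp.ext (funext fun n => ?_)
  have h1 : lowLift d L M (lowCoord d L M z) n =
      ∑ l : Low d L M, (weight L l.1 : ℂ)⁻¹ * z l.1 * weightedWave L l.1 n := by
    rw [lowLift_apply, lp.coeFn_sum, Finset.sum_apply]
    rfl
  have h2 : (z - highProj L M z) n = z n - highProj L M z n := rfl
  rw [h1, h2]
  by_cases hn : IsLow L M n
  · rw [highProj_apply_low _ hn, sub_zero, Finset.sum_eq_single_of_mem ⟨n, hn⟩ (Finset.mem_univ _)]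
    · have := ofReal_weight_ne_zero L n
      rw [weightedWave_self]
      field_simp
    · intro l _ hl
      rw [weightedWave_of_ne fun h => hl (Subtype.ext h.symm), mul_zero]
  · rw [highProj_apply_high _ hn, sub_self]
    refine Finset.sum_eq_zero fun l _ => ?_
    rw [weightedWave_of_ne fun h : n = l.1 => hn (h ▸ l.2), mul_zero]

end EffectiveHamiltonian

end FeshbachSchur

end

/-! ### Eigenvalue curves and their fixed points -/

noncomputable section

namespace FeshbachSchur

section FixedPoint

variable {d : ℕ} {L r N : ℝ} {V : Freq d → ℂ} {M : ℕ}

theorem nu_eq {t : ℝ} (h : (effHamiltonian L V M t).IsHermitian)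
    (i : Fin (Fintype.card (Low d L M))) : nu L V M i t = h.eigenvalues₀ i.rev :=
  dif_pos h

/-- Eigenfunctions of `-Δ + V` come from the kernels of the pencil. -/
theorem eigenSpan_le (hr : 0 < r) (hB : IsBoundedHermitian (potMatrix L r V) N) (μ : ℝ) :
    eigenSpan L V (Set.Iic μ) ≤
      (⨆ ν : Set.Iic μ, (pencil hr hB ν).ker).map
        ((invSqrtOp L : L2per d →L[ℂ] L2per d) : L2per d →ₗ[ℂ] L2per d) := by
  refine Submodule.span_le.mpr ?_
  rintro φ ⟨ν, hν, hφ, heq⟩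
  set z : L2per d := ⟨_, memHs_one_iff L |>.mp hφ⟩ with hz
  have hzφ : (fun n => (weight L n : ℂ)⁻¹ * z n) = φ :=
    funext fun n => inv_mul_cancel_left₀ (ofReal_weight_ne_zero L n) (φ n)
  refine ⟨z, Submodule.mem_iSup_of_mem ⟨ν, hν⟩ (LinearMap.mem_ker.mpr ?_), lp.ext ?_⟩
  · refine lp.ext (funext fun n => ?_)
    refine (mul_eq_zero.mp ?_).resolve_left (ofReal_weight_ne_zero L n)
    have h := pencil_apply hr hB ν z n
    rw [hzφ, congrFun hzφ n, heq n, sub_self] at h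
    exact h
  · rw [← hzφ]
    refine funext fun n => ?_
    change (((weight L n)⁻¹ : ℝ) : ℂ) * z n = _
    rw [Complex.ofReal_inv]

/-- At an eigenvalue `μ` of `-Δ + V` number `i`, at least `i + 1` eigenvalues of `H_M(μ)` are at
most `μ`. -/
theorem nu_le_of_rank_le (hr : 0 < r) (hB : IsBoundedHermitian (potMatrix L r V) N) {μ δ : ℝ}
    (hδ : 0 < δ) (hc : ∀ z : L2per d, highProj L M z = z →
      δ * ‖z‖ ^ 2 ≤ (inner ℂ z (pencil hr hB μ z)).re) (i : Fin (Fintype.card (Low d L M)))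
    (hi : (((i : ℕ) + 1 : ℕ) : Cardinal) ≤ Module.rank ℂ (eigenSpan L V (Set.Iic μ))) :
    nu L V M i μ ≤ μ := by
  obtain ⟨R, hR⟩ := exists_isCompressedInverse isSymmetric_highProj highProj_highProj hδ hc
  have hA := isSymmetric_sub_smul (isSymmetric_energyOp hr hB) (isSymmetric_invOp (L := L)) μ
  set F : Submodule ℂ (L2per d) := ⨆ ν : Set.Iic μ, (pencil hr hB ν).ker with hF
  have hFneg : ∀ z ∈ F, (inner ℂ z (pencil hr hB μ z)).re ≤ 0 := fun z hz =>
    re_inner_pencil_nonpos (isSymmetric_energyOp hr hB) isSymmetric_invOp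
      re_inner_invOp_nonneg hz
  have hrank : (((i : ℕ) + 1 : ℕ) : Cardinal) ≤ Module.rank ℂ F :=
    hi.trans ((Submodule.rank_mono (eigenSpan_le hr hB μ)).trans (rank_map_le _ F))
  obtain ⟨v, hv⟩ := Module.le_rank_iff.mp hrank
  -- A purely high vector of `F` has a form both nonpositive and at least `δ‖z‖²`, so it is zero;
  -- projecting to `X_M` loses no dimension.
  have hker : LinearMap.ker ((lowCoord d L M).comp F.subtype) = ⊥ := by
    refine LinearMap.ker_eq_bot'.mpr fun z hz => Subtype.ext ?_
    have h1 := lowLift_lowCoord (M := M) (L := L) (z : L2per d)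
    have h2 : lowCoord d L M (z : L2per d) = 0 := hz
    rw [h2, map_zero] at h1
    have h3 := hc z (sub_eq_zero.mp h1.symm).symm
    have h4 := hFneg z z.2
    have h5 : ‖(z : L2per d)‖ ^ 2 = 0 :=
      le_antisymm (by nlinarith [sq_nonneg ‖(z : L2per d)‖]) (sq_nonneg _)
    exact norm_eq_zero.mp (pow_eq_zero_iff two_ne_zero |>.mp h5)
  have hli := hv.map' _ hker
  rw [nu_eq (isHermitian_effHamiltonian hR hδ hc)]
  refine Matrix.IsHermitian.eigenvalues₀_rev_le _ i (Submodule.span ℂ (Set.range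
    ((lowCoord d L M).comp F.subtype ∘ v))) (by rw [finrank_span_eq_card hli]; simp) ?_
  intro u hu
  obtain ⟨z, hz⟩ : ∃ z : F, (lowCoord d L M).comp F.subtype z = u := by
    refine (Submodule.span_le (p := LinearMap.range ((lowCoord d L M).comp F.subtype))).mpr ?_ hu
    rintro _ ⟨j, rfl⟩
    exact ⟨v j, rfl⟩
  have hz' : lowCoord d L M (z : L2per d) = u := hz
  rw [inner_effHamiltonian hR hδ hc, re_inner_lowLift_invOp, add_le_iff_nonpos_left]
  -- The competitor is the high part of `z`: added to the lift of `u`, it gives back `z`.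
  refine (hR.inner_schur_le isSymmetric_highProj hA
    (fun x hx => le_trans (by positivity) (hc x hx)) _ (highProj_highProj (z : L2per d))).trans ?_
  rw [← hz', lowLift_lowCoord, sub_add_cancel]
  exact hFneg z z.2

/-- The forms are ordered vector by vector, so Weyl's principle applies with zero error. -/
theorem nu_antitone (hr : 0 < r) (hB : IsBoundedHermitian (potMatrix L r V) N) {b δ : ℝ}
    (hδ : 0 < δ) (hc : ∀ t ≤ b, ∀ z : L2per d, highProj L M z = z →
      δ * ‖z‖ ^ 2 ≤ (inner ℂ z (pencil hr hB t z)).re) (i : Fin (Fintype.card (Low d L M)))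
    {t₁ t₂ : ℝ} (ht : t₁ ≤ t₂) (hb : t₂ ≤ b) : nu L V M i t₂ ≤ nu L V M i t₁ := by
  have hc₁ := hc t₁ (ht.trans hb)
  have hc₂ := hc t₂ hb
  obtain ⟨R₁, h₁⟩ := exists_isCompressedInverse isSymmetric_highProj highProj_highProj hδ hc₁
  obtain ⟨R₂, h₂⟩ := exists_isCompressedInverse isSymmetric_highProj highProj_highProj hδ hc₂
  rw [nu_eq (isHermitian_effHamiltonian h₁ hδ hc₁), nu_eq (isHermitian_effHamiltonian h₂ hδ hc₂),
    ← add_zero (Matrix.IsHermitian.eigenvalues₀ (isHermitian_effHamiltonian h₁ hδ hc₁) _)]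
  refine Matrix.IsHermitian.eigenvalues₀_rev_le_add _ _ i fun u => ?_
  rw [inner_effHamiltonian h₁ hδ hc₁, inner_effHamiltonian h₂ hδ hc₂, zero_mul, add_zero]
  exact effective_form_antitone isSymmetric_highProj (isSymmetric_energyOp hr hB)
    isSymmetric_invOp highProj_invOp re_inner_invOp_nonneg h₁ h₂
    (fun x hx => le_trans (by positivity) (hc₂ x hx)) ht (highProj_lowLift u)

/-- One `K` serves the whole half-line because `δ` does; `‖lowLift‖` converts coordinate norms to ℓ²
norms. -/
theorem exists_nu_le_add (hr : 0 < r) (hB : IsBoundedHermitian (potMatrix L r V) N) {b δ : ℝ}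
    (hδ : 0 < δ) (hc : ∀ t ≤ b, ∀ z : L2per d, highProj L M z = z →
      δ * ‖z‖ ^ 2 ≤ (inner ℂ z (pencil hr hB t z)).re) (i : Fin (Fintype.card (Low d L M))) :
    ∃ K : ℝ, 0 ≤ K ∧ ∀ t₁ t₂, t₁ ≤ t₂ → t₂ ≤ b →
      nu L V M i t₁ ≤ nu L V M i t₂ + K * (t₂ - t₁) := by
  set K₀ := ‖(invOp L : L2per d →L[ℂ] L2per d)‖ *
    (‖(highProj L M).comp (energyOp hr hB)‖ / δ) ^ 2 with hK₀
  refine ⟨K₀ * ‖lowLift d L M‖ ^ 2, by positivity, fun t₁ t₂ ht hb => ?_⟩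
  have hc₁ := hc t₁ (ht.trans hb)
  have hc₂ := hc t₂ hb
  obtain ⟨R₁, h₁⟩ := exists_isCompressedInverse isSymmetric_highProj highProj_highProj hδ hc₁
  obtain ⟨R₂, h₂⟩ := exists_isCompressedInverse isSymmetric_highProj highProj_highProj hδ hc₂
  rw [nu_eq (isHermitian_effHamiltonian h₁ hδ hc₁), nu_eq (isHermitian_effHamiltonian h₂ hδ hc₂)]
  refine Matrix.IsHermitian.eigenvalues₀_rev_le_add _ _ i fun u => ?_
  rw [inner_effHamiltonian h₁ hδ hc₁, inner_effHamiltonian h₂ hδ hc₂]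
  refine (effective_form_le_add isSymmetric_highProj (isSymmetric_energyOp hr hB)
    isSymmetric_invOp highProj_invOp hδ h₁ h₂
    (fun x hx => le_trans (by positivity) (hc₁ x hx)) hc₂ ht (highProj_lowLift u)).trans ?_
  have h : ‖lowLift d L M u‖ ^ 2 ≤ ‖lowLift d L M‖ ^ 2 * ‖u‖ ^ 2 := by
    rw [← mul_pow]
    gcongr
    exact (lowLift d L M).le_opNorm u
  have h' := mul_le_mul_of_nonneg_left h
    (mul_nonneg (sub_nonneg.mpr ht) (by positivity : 0 ≤ K₀))
  rw [← hK₀]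
  linarith

/-- An antitone, one-sided Lipschitz function which is at most `b` at `b` has a fixed point in
`(-∞, b]`. -/
theorem exists_fixed_point_of_antitone {f : ℝ → ℝ} {b K : ℝ} (hK : 0 ≤ K)
    (hanti : ∀ s t, s ≤ t → t ≤ b → f t ≤ f s)
    (hlip : ∀ s t, s ≤ t → t ≤ b → f s ≤ f t + K * (t - s)) (hb : f b ≤ b) :
    ∃ t ≤ b, f t = t := by
  have hcont : ContinuousOn f (Set.Iic b) := by
    refine (LipschitzOnWith.of_le_add_mul' K fun x hx y hy => ?_).continuousOn
    rcases le_total x y with h | h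
    · rw [dist_comm, Real.dist_eq, abs_of_nonneg (sub_nonneg.mpr h)]
      exact hlip x y h hy
    · exact (hanti y x h hx).trans (le_add_of_nonneg_right (by positivity))
  -- The left endpoint is `f b`: as `f b ≤ b`, antitonicity gives `f (f b) ≥ f b`, the opposite sign
  -- to that at `b`.
  have hcont' : ContinuousOn (fun t => f t - t) (Set.Icc (f b) b) :=
    (hcont.mono fun t ht => ht.2).sub continuousOn_id
  obtain ⟨t, ht, h0⟩ := intermediate_value_Icc' hb hcont'
    ⟨sub_nonpos.mpr hb, sub_nonneg.mpr (hanti _ b hb le_rfl)⟩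
  exact ⟨t, ht.2, sub_eq_zero.mp h0⟩

end FixedPoint

end FeshbachSchur

end

theorem proposition2p3 (d : ℕ) (L : ℝ) (hL : 0 < L)
    (V : FeshbachSchur.Freq d → ℂ) (hVreal : FeshbachSchur.IsRealPot V)
    (r : ℝ) (hr : 0 < r) (hVr : FeshbachSchur.potNorm L r V ≠ ⊤)
    (M : ℕ) (hM : 1 ≤ M)
    (hMV : FeshbachSchur.rho L M ^ (-r) * (FeshbachSchur.potNorm L r V).toReal ≤ 1) :
    (∀ lam : ℝ, lam < FeshbachSchur.kappa L r V M →
      FeshbachSchur.PerpInvertible L V M lam ∧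
      (FeshbachSchur.effHamiltonian L V M lam).IsHermitian) ∧
    ∀ i : Fin (Fintype.card (FeshbachSchur.Low d L M)),
      (∀ lam₁ < FeshbachSchur.kappa L r V M, ∀ lam₂ < FeshbachSchur.kappa L r V M,
        FeshbachSchur.nu L V M i lam₁ = lam₁ → FeshbachSchur.nu L V M i lam₂ = lam₂ →
          lam₁ = lam₂) ∧
      ∀ μ : ℝ, FeshbachSchur.IsNthEigenvalue L V i μ → μ < FeshbachSchur.kappa L r V M →
        ∃! lam : ℝ, lam < FeshbachSchur.kappa L r V M ∧ FeshbachSchur.nu L V M i lam = lam := by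
  open FeshbachSchur in
  have hB := isBoundedHermitian_potMatrix L hVreal hVr
  have hρ : 0 < rho L M := by
    have : (0 : ℝ) < M := by exact_mod_cast hM
    unfold rho
    positivity
  have hcoer := fun (b : ℝ) (hb : b < kappa L r V M) =>
    exists_coercive (M := M) hr hB hρ hMV hb
  have huniq : ∀ i, ∀ lam₁ < kappa L r V M, ∀ lam₂ < kappa L r V M,
      nu L V M i lam₁ = lam₁ → nu L V M i lam₂ = lam₂ → lam₁ = lam₂ := by
    intro i lam₁ h₁ lam₂ h₂ e₁ e₂
    wlog hle : lam₁ ≤ lam₂ generalizing lam₁ lam₂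
    · exact (this lam₂ h₂ lam₁ h₁ e₂ e₁ (le_of_not_ge hle)).symm
    -- Taking `b = lam₂` covers both solutions, and antitonicity turns `lam₁ ≤ lam₂` into `lam₂ ≤
    -- lam₁`.
    obtain ⟨δ, hδ, hc⟩ := hcoer lam₂ h₂
    have h := nu_antitone hr hB hδ hc i hle le_rfl
    rw [e₁, e₂] at h
    exact le_antisymm hle h
  refine ⟨fun lam hlam => ?_, fun i => ⟨huniq i, fun μ hμ hμκ => ?_⟩⟩
  · obtain ⟨δ, hδ, hc⟩ := hcoer lam hlam
    have hc' := hc lam le_rfl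
    obtain ⟨R, hR⟩ := exists_isCompressedInverse isSymmetric_highProj highProj_highProj hδ hc'
    exact ⟨perpInvertible_of_coercive hR hδ hc', isHermitian_effHamiltonian hR hδ hc'⟩
  · obtain ⟨δ, hδ, hc⟩ := hcoer μ hμκ
    obtain ⟨K, hK, hlip⟩ := exists_nu_le_add hr hB hδ hc i
    -- With `b = μ` the fixed point found is at most `μ`, hence below `κ_M`.
    obtain ⟨lam, hle, hfix⟩ := exists_fixed_point_of_antitone hK
      (fun s t hst ht => nu_antitone hr hB hδ hc i hst ht) hlip
      (nu_le_of_rank_le hr hB hδ (hc μ le_rfl) i hμ.2)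
    exact ⟨lam, ⟨hle.trans_lt hμκ, hfix⟩,
      fun t ht => huniq i t ht.1 lam (hle.trans_lt hμκ) ht.2 hfix⟩
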